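/- Let $(X,\mu)$ and $(Y,\nu)$ be $\sigma$-finite measure spaces with $\mu(X)=\nu(Y)=\infty$, the latter nonatomic and separable. Let $1<p<\infty$, $1\le r<p$, $p_1=p/r$ and $p_1'=p_1/(p_1-1)=p/(p-r)$. Let $\Phi_i(t)=\int_0^t\phi_i(s)\,ds$, $i=1,2$, be Young functions, where $\phi_i:(0,\infty)\to[0,\infty)$ is nondecreasing, left-continuous, not identically zero and $\phi_i(0^+)=0$. Let $L_{\Phi_i}$ be the Orlicz space of all measurable $f$ with $\int\Phi_i(k|f|)<\infty$ for some $k>0$, with the gauge norm $\|f\|_{L_{\Phi_i}}=\inf\{\lambda>0:\int\Phi_i(|f|/\lambda)\le 1\}$. For a set $\mathcal D$ of measurable functions on $X$, let $W_{\mathcal D}$ be the class of operators $T$ from $\mathcal D$ to the $\nu$-measurable functions on $Y$ for which there are constants $C,M,M_\infty>0$ and $0<c<1$ such that, for all $f,f_1,f_2\in\mathcal D$ and all $t,\lambda>0$, $$[T(f_1+f_2)]^*(t)\le C\big([Tf_1]^*(ct)+[Tf_2]^*(ct)\big),$$ $$\lambda\,\nu(\{|Tf|>\lambda\})^{1/p}\le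 M\Big(r\int_0^\infty \mu(\{|f|>s\})^{r/p}s^{r-1}ds\Big)^{1/r},\qquad \|Tf\|_{L_\infty(Y,\nu)}\le M_\infty\|f\|_{L_\infty(X,\mu)},$$ where $g^*(t)=\inf\{s>0: |\{|g|>s\}|\le t\}$ is the decreasing rearrangement (of functions on $Y$, with respect to $\nu$). The class $W((p,r),(\infty,\infty);\mu,\nu)$ is taken with either of two domains: $\mathcal D=S(X)$, the measurable functions with finitely many values, or $\mathcal D=(L_{p,r}+L_\infty)(X,\mu)$. Consider the statements (1a) to each $T\in W_{S(X)}$ there corresponds $C>0$ with $\|Tf\|_{L_{\Phi_1}(Y,\nu)}\le C\|f\|_{L_{\Phi_2}(X,\mu)}$ for all $f\in S(X)\cap L_{\Phi_2}(X,\mu)$; (1b) to each $T\in W_{L_{p,r}+L_\infty}$ there corresponds $C>0$ such that every $f\in L_{\Phi_2}(X,\mu)$ belongs to $(L_{p,r}+L_\infty)(X,\mu)$ and satisfies $\|Tf\|_{L_{\Phi_1}(Y,\nu)}\le C\|f\|_{L_{\Phi_2}(X,\mu)}$; (2) there exist $B,D>0$ such that for all $x>0$ $$\left(\int_x^\infty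 \frac{\phi_2(Dy)}{\Phi_2(Dy)^{p_1'}}\,y^{rp_1'}\,dy\right)^{1/p_1'}\left(\int_0^x\frac{\phi_1(y)}{y^p}\,dy\right)^{1/p_1}\le B$$ (integrals in $[0,\infty]$, with $0\cdot\infty=0$, and the first integrand read as $0$ where $\phi_2(Dy)=\Phi_2(Dy)=0$). Then (2) implies both (1a) and (1b). If moreover $(X,\mu)$ is nonatomic, then (1a) and (2) are equivalent, and (1b) and (2) are equivalent. -/

import Mathlib

open MeasureTheory Set Filter Topology
open scoped ENNReal

noncomputable section

/-- `φ`, restricted to `(0, ∞)`, is the density of a Young function: it is nonnegative (and finite),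
increasing, left-continuous, tends to `0` at `0+` and is not identically zero.  The values of `φ`
outside `(0, ∞)` play no role. -/
structure IsYoungDensity (φ : ℝ → ℝ) : Prop where
  nonneg : ∀ t, 0 < t → 0 ≤ φ t
  mono : MonotoneOn φ (Ioi 0)
  leftCont : ∀ t, 0 < t → ContinuousWithinAt φ (Iio t) t
  tendsto_zero : Tendsto φ (𝓝[>] 0) (𝓝 0)
  nontrivial : ∃ t, 0 < t ∧ φ t ≠ 0

/-- The Young function `Φ(t) = ∫₀ᵗ φ(s) ds`. -/
def youngFun (φ : ℝ → ℝ) (t : ℝ) : ℝ := ∫ s in (0 : ℝ)..t, φ s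

/-- The Orlicz space `L_Φ(X, μ)`. -/
def OrliczSpace {X : Type*} [MeasurableSpace X] (Φ : ℝ → ℝ) (μ : Measure X) : Set (X → ℝ) :=
  {f | Measurable f ∧ ∃ k : ℝ, 0 < k ∧ ∫⁻ x, ENNReal.ofReal (Φ (k * |f x|)) ∂μ < ∞}

/-- The gauge (Luxemburg) norm of `L_Φ(X, μ)`, with values in `[0, ∞]`. -/
def gaugeNorm {X : Type*} [MeasurableSpace X] (Φ : ℝ → ℝ) (μ : Measure X) (f : X → ℝ) : ℝ≥0∞ :=
  ⨅ (l : ℝ) (_ : 0 < l) (_ : ∫⁻ x, ENNReal.ofReal (Φ (|f x| / l)) ∂μ ≤ 1), ENNReal.ofReal l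

/-- The distribution function `s ↦ μ {x : |f x| > s}`. -/
def distribFun {X : Type*} [MeasurableSpace X] (μ : Measure X) (f : X → ℝ) (s : ℝ) : ℝ≥0∞ :=
  μ {x | s < |f x|}

/-- The decreasing rearrangement `f*(t) = inf {s > 0 : μ {|f| > s} ≤ t}`. -/
def decRearr {X : Type*} [MeasurableSpace X] (μ : Measure X) (f : X → ℝ) (t : ℝ) : ℝ≥0∞ :=
  ⨅ (s : ℝ) (_ : 0 < s) (_ : distribFun μ f s ≤ ENNReal.ofReal t), ENNReal.ofReal s

/-- The Lorentz functional `‖f‖_{p,r} = (r ∫₀^∞ μ {|f| > t}^{r/p} t^{r-1} dt)^{1/r}`. -/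
def lorentzNorm {X : Type*} [MeasurableSpace X] (p r : ℝ) (μ : Measure X) (f : X → ℝ) : ℝ≥0∞ :=
  (ENNReal.ofReal r *
    ∫⁻ t in Ioi (0 : ℝ), distribFun μ f t ^ (r / p) * ENNReal.ofReal (t ^ (r - 1))) ^ (1 / r)

/-- `S(X)`: the measurable functions with finitely many values. -/
def simpleFunctions (X : Type*) [MeasurableSpace X] : Set (X → ℝ) :=
  {f | Measurable f ∧ (range f).Finite}

/-- The sum space `(L_{p,r} + L_∞)(X, μ)`. -/
def lorentzAddLinfty {X : Type*} [MeasurableSpace X] (p r : ℝ) (μ : Measure X) : Set (X → ℝ) :=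
  {f | ∃ g h : X → ℝ, Measurable g ∧ Measurable h ∧ lorentzNorm p r μ g < ∞ ∧
    eLpNorm h ∞ μ < ∞ ∧ f = g + h}

/-- `T`, an operator with domain `𝓓` (its values outside `𝓓` are irrelevant), belongs to
`W((p,r),(∞,∞);μ,ν)`. -/
structure InClassW {X Y : Type*} [MeasurableSpace X] [MeasurableSpace Y] (p r : ℝ)
    (μ : Measure X) (ν : Measure Y) (𝓓 : Set (X → ℝ)) (T : (X → ℝ) → (Y → ℝ)) : Prop where
  measurable : ∀ f ∈ 𝓓, Measurable (T f)
  /-- `T` is `r`-quasilinear -/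
  quasilinear : ∃ C c : ℝ, 0 < C ∧ 0 < c ∧ c < 1 ∧ ∀ f₁ ∈ 𝓓, ∀ f₂ ∈ 𝓓, ∀ t : ℝ, 0 < t →
    decRearr ν (T (f₁ + f₂)) t ≤
      ENNReal.ofReal C * (decRearr ν (T f₁) (c * t) + decRearr ν (T f₂) (c * t))
  /-- `T` is of weak type `(p,r)` -/
  weakType : ∃ M : ℝ, 0 < M ∧ ∀ f ∈ 𝓓, ∀ l : ℝ, 0 < l →
    ENNReal.ofReal l * distribFun ν (T f) l ^ (1 / p) ≤ ENNReal.ofReal M * lorentzNorm p r μ f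
  /-- `T` is bounded from `L_∞` to `L_∞` -/
  bounded : ∃ M : ℝ, 0 < M ∧ ∀ f ∈ 𝓓, eLpNorm (T f) ∞ ν ≤ ENNReal.ofReal M * eLpNorm f ∞ μ

/-- Every `T` in `W((p,r),(∞,∞);μ,ν)` with domain `S(X)` is bounded from `L_{Φ₂}(X, μ)` to
`L_{Φ₁}(Y, ν)` on its domain. -/
def BoundedOnSimple {X Y : Type*} [MeasurableSpace X] [MeasurableSpace Y] (p r : ℝ)
    (μ : Measure X) (ν : Measure Y) (Φ₁ Φ₂ : ℝ → ℝ) : Prop :=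
  ∀ T : (X → ℝ) → (Y → ℝ), InClassW p r μ ν (simpleFunctions X) T →
    ∃ C : ℝ, 0 < C ∧ ∀ f ∈ simpleFunctions X, f ∈ OrliczSpace Φ₂ μ →
      gaugeNorm Φ₁ ν (T f) ≤ ENNReal.ofReal C * gaugeNorm Φ₂ μ f

/-- Every `T` in `W((p,r),(∞,∞);μ,ν)` with domain `(L_{p,r} + L_∞)(X, μ)` is defined on all of
`L_{Φ₂}(X, μ)` and bounded from there to `L_{Φ₁}(Y, ν)`. -/
def BoundedOnOrlicz {X Y : Type*} [MeasurableSpace X] [MeasurableSpace Y] (p r : ℝ)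
    (μ : Measure X) (ν : Measure Y) (Φ₁ Φ₂ : ℝ → ℝ) : Prop :=
  ∀ T : (X → ℝ) → (Y → ℝ), InClassW p r μ ν (lorentzAddLinfty p r μ) T →
    ∃ C : ℝ, 0 < C ∧ ∀ f ∈ OrliczSpace Φ₂ μ, f ∈ lorentzAddLinfty p r μ ∧
      gaugeNorm Φ₁ ν (T f) ≤ ENNReal.ofReal C * gaugeNorm Φ₂ μ f

/-- The measure has no atoms: every measurable set of positive measure has a measurable subset of
strictly smaller positive measure (stronger than the null singletons of Mathlib's `NoAtoms`). -/
def IsNonatomic {X : Type*} [MeasurableSpace X] (μ : Measure X) : Prop :=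
  ∀ A, MeasurableSet A → 0 < μ A → ∃ B ⊆ A, MeasurableSet B ∧ 0 < μ B ∧ μ B < μ A

/-- The Cianchi-type condition, with `p₁ = p / r` and `p₁' = p₁ / (p₁ - 1)`.  Both integrals
take values in `[0, ∞]`, and `0 · ∞ = 0`. -/
def CianchiCondition (p r : ℝ) (φ₁ φ₂ : ℝ → ℝ) : Prop :=
  ∃ B D : ℝ, 0 < B ∧ 0 < D ∧ ∀ x : ℝ, 0 < x →
    (∫⁻ y in Ioi x, ENNReal.ofReal
        (φ₂ (D * y) / youngFun φ₂ (D * y) ^ (Real.conjExponent (p / r)) *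
          y ^ (r * Real.conjExponent (p / r)))) ^ (1 / Real.conjExponent (p / r)) *
      (∫⁻ y in Ioo 0 x, ENNReal.ofReal (φ₁ y / y ^ p)) ^ (1 / (p / r)) ≤ ENNReal.ofReal B

end

/-! Write q = p/r, q' for its conjugate exponent, and μ_f for the distribution function of f.

Sufficiency. Cut f at height l, so that f is a part bounded by l plus a remainder f^l. The L_∞ bound
on the first, the weak type (p,r) on the second and quasilinearity give ν{|Tf| > Kl} ≤ A
(‖f^l‖_{p,r} / l)^p, where ‖f^l‖_{p,r}^r ≤ r ∫_l^∞ μ_f^{r/p} s^{r-1} ds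
(`InClassW.exists_distribFun_le`, `lorentzNorm_sub_truncAt_rpow_le`). Integrating against φ₁ bounds
the Φ₁-modular of Tf by ∫ φ₁(l) l^{-p} (∫_l^∞ μ_f^{1/q} s^{r-1} ds)^q dl up to constants. This is a
Hardy operator, controlled by Muckenhoupt's two-weight inequality `lintegral_rpow_lintegral_Ioi_le`.
With the weight u(y) = φ₂(y) Φ₂(y)^{-q'} y^{rq'} on the inner integral, Muckenhoupt's condition is
exactly (2), once D has been absorbed by dilating Φ₂; and Φ₂(s) ≤ s φ₂(s) bounds the right-hand side
by ∫ μ_f φ₂ = ∫ Φ₂(|f|) (`hardy_young`).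

Necessity. One operator suffices: the Calderón function t ↦ t^{-1/p} ‖f* χ_(0,t)‖_{p,r}, composed
with some ψ on Y for which ν{ψ ≤ t} is comparable to t (nonatomicity of ν). If the nonzero values of
f have modulus at least x₀, then ν{Tf > l} ≥ (‖f‖_{p,r}/l)^p / 4 for l < x₀
(`le_distribFun_calderonOp`). Boundedness with constant C therefore yields (∫_0^{x₀/2C} φ₁ y^{-p}
dy) (‖f‖_{p,r}/2C)^p ≤ 4 for every such simple f of Φ₂-modular at most 1. Nonatomicity of μ gives
step functions with values 2^j z on sets of prescribed measure; taking the measures of the equality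
case of Hölder produces (∑ a_j)^{1/q'} with a_j = (2^j z)^{rq'} Φ₂(2^j z)^{1-q'}, and ∑ a_j
dominates the tail integral in (2) (`IsYoungDensity.lintegral_weight_le_tsum`). The operator belongs
to the class on both domains, so it settles (1a) and (1b) together. -/

namespace IsYoungDensity

/-! ### Elementary properties of Young functions -/

variable {φ : ℝ → ℝ}

lemma intervalIntegrable (hφ : IsYoungDensity φ) {a b : ℝ} (ha : 0 ≤ a) (hb : 0 ≤ b) :
    IntervalIntegrable φ volume a b := by
  have key : ∀ t : ℝ, 0 < t → IntervalIntegrable φ volume 0 t := by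
    intro t ht
    rw [intervalIntegrable_iff_integrableOn_Ioc_of_le ht.le]
    have hm : AEMeasurable φ (volume.restrict (Ioc 0 t)) :=
      aemeasurable_restrict_of_monotoneOn measurableSet_Ioc (hφ.mono.mono Ioc_subset_Ioi_self)
    refine Integrable.of_bound hm.aestronglyMeasurable (φ t) ?_
    refine (ae_restrict_mem measurableSet_Ioc).mono fun s hs => ?_
    rw [Real.norm_of_nonneg (hφ.nonneg s hs.1)]
    exact hφ.mono hs.1 ht hs.2
  have key' : ∀ t : ℝ, 0 ≤ t → IntervalIntegrable φ volume 0 t := by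
    intro t ht
    rcases ht.eq_or_lt with rfl | h
    · simp
    · exact key t h
  exact (key' a ha).symm.trans (key' b hb)

lemma aemeasurable_restrict_pos (hφ : IsYoungDensity φ) {s : Set ℝ} (hs : MeasurableSet s)
    (h : s ⊆ Ioi 0) : AEMeasurable φ (volume.restrict s) :=
  aemeasurable_restrict_of_monotoneOn hs (hφ.mono.mono h)

lemma youngFun_sub (hφ : IsYoungDensity φ) {a b : ℝ} (ha : 0 ≤ a) (hb : 0 ≤ b) :
    youngFun φ b - youngFun φ a = ∫ s in a..b, φ s := by
  unfold youngFun
  exact intervalIntegral.integral_interval_sub_left (hφ.intervalIntegrable le_rfl hb)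
    (hφ.intervalIntegrable le_rfl ha)

lemma ofReal_youngFun_sub (hφ : IsYoungDensity φ) {a b : ℝ} (ha : 0 ≤ a) (hab : a ≤ b) :
    ENNReal.ofReal (youngFun φ b - youngFun φ a) = ∫⁻ s in Ioc a b, ENNReal.ofReal (φ s) := by
  rw [hφ.youngFun_sub ha (ha.trans hab), intervalIntegral.integral_of_le hab,
    ofReal_integral_eq_lintegral_ofReal]
  · exact (hφ.intervalIntegrable ha (ha.trans hab)).1
  · exact (ae_restrict_mem measurableSet_Ioc).mono fun s hs => hφ.nonneg s (ha.trans_lt hs.1)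

@[simp] lemma _root_.youngFun_zero : youngFun φ 0 = 0 := by simp [youngFun]

lemma sub_le (hφ : IsYoungDensity φ) {a b : ℝ} (ha : 0 ≤ a) (hab : a < b) :
    youngFun φ b - youngFun φ a ≤ (b - a) * φ b := by
  rw [hφ.youngFun_sub ha (ha.trans hab.le)]
  have := intervalIntegral.integral_mono_on_of_le_Ioo hab.le
    (hφ.intervalIntegrable ha (ha.trans hab.le)) (intervalIntegrable_const (c := φ b))
    (fun s hs => hφ.mono (ha.trans_lt hs.1) (ha.trans_lt hab) hs.2.le)
  simpa using this

lemma le_sub (hφ : IsYoungDensity φ) {a b : ℝ} (ha : 0 < a) (hab : a ≤ b) :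
    (b - a) * φ a ≤ youngFun φ b - youngFun φ a := by
  rw [hφ.youngFun_sub ha.le (ha.le.trans hab)]
  have := intervalIntegral.integral_mono_on_of_le_Ioo hab (intervalIntegrable_const (c := φ a))
    (hφ.intervalIntegrable ha.le (ha.le.trans hab))
    (fun s hs => hφ.mono ha (ha.trans hs.1) hs.1.le)
  simpa using this

lemma youngFun_mono (hφ : IsYoungDensity φ) : MonotoneOn (youngFun φ) (Ici 0) := by
  intro a ha b hb hab
  have ha' : (0 : ℝ) ≤ a := ha
  rw [← sub_nonneg, hφ.youngFun_sub ha hb]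
  exact intervalIntegral.integral_nonneg_of_ae_restrict hab
    ((ae_restrict_iff' measurableSet_Icc).2 (by
      filter_upwards [Measure.ae_ne volume (0:ℝ)] with s hs hs'
      exact hφ.nonneg s (lt_of_le_of_ne (ha'.trans hs'.1) hs.symm)))

lemma youngFun_nonneg (hφ : IsYoungDensity φ) {t : ℝ} (ht : 0 ≤ t) : 0 ≤ youngFun φ t := by
  simpa using hφ.youngFun_mono (mem_Ici.2 le_rfl) (mem_Ici.2 ht) ht

lemma youngFun_le_mul (hφ : IsYoungDensity φ) {t : ℝ} (ht : 0 < t) :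
    youngFun φ t ≤ t * φ t := by
  simpa using hφ.sub_le le_rfl ht

lemma exists_pos (hφ : IsYoungDensity φ) : ∃ t, 0 < t ∧ 0 < φ t := by
  obtain ⟨t, ht, h⟩ := hφ.nontrivial
  exact ⟨t, ht, lt_of_le_of_ne (hφ.nonneg t ht) (Ne.symm h)⟩

lemma youngFun_unbounded (hφ : IsYoungDensity φ) (M : ℝ) : ∃ t, 0 < t ∧ M < youngFun φ t := by
  obtain ⟨t, ht, h⟩ := hφ.exists_pos
  have hM : 0 ≤ |M| / φ t := by positivity
  refine ⟨t + |M| / φ t + 1, by positivity, ?_⟩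
  have := hφ.le_sub ht (b := t + |M| / φ t + 1) (by linarith)
  have h0 := hφ.youngFun_nonneg ht.le
  have e : (t + |M| / φ t + 1 - t) * φ t = |M| + φ t := by field_simp; ring
  rw [e] at this
  linarith [le_abs_self M]

/-- Monotonicity kills φ on (0, t), and left-continuity excludes a jump at t itself. Hence φ/Φ^b is
0/0 wherever Φ vanishes, which Lean evaluates to 0 as the condition prescribes. -/
lemma density_eq_zero (hφ : IsYoungDensity φ) {t : ℝ} (ht : 0 < t) (h : youngFun φ t = 0) :
    φ t = 0 := by
  have hlt : ∀ s ∈ Ioo 0 t, φ s = 0 := by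
    intro s hs
    have h1 := hφ.le_sub hs.1 hs.2.le
    have h2 := hφ.youngFun_nonneg hs.1.le
    have h3 := hφ.nonneg s hs.1
    have h4 : 0 < t - s := by linarith [hs.2]
    have : (t - s) * φ s ≤ 0 := by linarith
    nlinarith
  have hc := hφ.leftCont t ht
  have : Tendsto φ (𝓝[<] t) (𝓝 0) := by
    refine tendsto_const_nhds.congr' ?_
    filter_upwards [Ioo_mem_nhdsLT ht] with s hs using (hlt s hs).symm
  exact tendsto_nhds_unique hc this

lemma density_pos (hφ : IsYoungDensity φ) {t : ℝ} (ht : 0 < t) (h : 0 < youngFun φ t) :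
    0 < φ t := by
  have := hφ.youngFun_le_mul ht
  by_contra! h'
  nlinarith

/-- Convexity with Φ(0) = 0: the mean of φ over (0, t/K) is at most φ(t/K), which is at most its
mean over (t/K, t). -/
lemma youngFun_div_le (hφ : IsYoungDensity φ) {t K : ℝ} (ht : 0 ≤ t) (hK : 1 ≤ K) :
    youngFun φ (t / K) ≤ youngFun φ t / K := by
  have hK0 : 0 < K := by linarith
  rcases ht.eq_or_lt with rfl | ht
  · simp
  have hs : 0 < t / K := by positivity
  have h1 := hφ.youngFun_le_mul hs
  have h2 := hφ.le_sub hs (b := t) (div_le_self ht.le hK)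
  have e : t - t / K = (K - 1) * (t / K) := by field_simp
  rw [le_div_iff₀ hK0]
  rw [e, mul_assoc] at h2
  nlinarith [mul_le_mul_of_nonneg_left h1 (sub_nonneg.2 hK)]

lemma continuousOn_youngFun (hφ : IsYoungDensity φ) : ContinuousOn (youngFun φ) (Ici 0) := by
  intro b hb
  have hb' : (0 : ℝ) ≤ b := hb
  have h := intervalIntegral.continuousOn_primitive_interval
    (f := φ) (μ := volume) (a := 0) (b := b + 1) (by
      rw [uIcc_of_le (by linarith), integrableOn_Icc_iff_integrableOn_Ioc]
      exact (hφ.intervalIntegrable le_rfl (by linarith)).1)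
  rw [uIcc_of_le (by linarith)] at h
  refine (h b ⟨hb, by linarith⟩).mono_of_mem_nhdsWithin ?_
  rw [← Ici_inter_Iic]
  exact inter_mem_nhdsWithin _ (Iic_mem_nhds (by linarith))

lemma measurable_youngFun_abs (hφ : IsYoungDensity φ) :
    Measurable fun t : ℝ => youngFun φ |t| := by
  have : Continuous fun t : ℝ => youngFun φ |t| :=
    hφ.continuousOn_youngFun.comp_continuous continuous_abs fun t => abs_nonneg t
  exact this.measurable

/-- Layer cake: modulars become weighted integrals of distribution functions, the form in which
Hardy's inequality applies. -/
lemma lintegral_youngFun (hφ : IsYoungDensity φ) {X : Type*} [MeasurableSpace X] (μ : Measure X)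
    {f : X → ℝ} (hf : Measurable f) :
    ∫⁻ x, ENNReal.ofReal (youngFun φ |f x|) ∂μ =
      ∫⁻ s in Ioi (0 : ℝ), distribFun μ f s * ENNReal.ofReal (φ s) := by
  refine lintegral_comp_eq_lintegral_meas_lt_mul μ (f := fun x => |f x|)
    (ae_of_all _ fun x => abs_nonneg _) hf.abs.aemeasurable
    (fun t ht => hφ.intervalIntegrable le_rfl (le_of_lt ht)) ?_
  exact (ae_restrict_mem measurableSet_Ioi).mono fun s hs => hφ.nonneg s hs

/-- Dilations of a Young density. -/
lemma dilate (hφ : IsYoungDensity φ) {D : ℝ} (hD : 0 < D) :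
    IsYoungDensity fun t => D * φ (D * t) where
  nonneg t ht := mul_nonneg hD.le (hφ.nonneg _ (mul_pos hD ht))
  mono a ha b hb hab := mul_le_mul_of_nonneg_left
    (hφ.mono (mul_pos hD ha) (mul_pos hD hb) (mul_le_mul_of_nonneg_left hab hD.le)) hD.le
  leftCont t ht := by
    refine ContinuousWithinAt.const_mul ?_ _ 
    refine ContinuousWithinAt.comp (t := Iio (D * t)) (hφ.leftCont _ (mul_pos hD ht))
      (continuous_const.mul continuous_id).continuousWithinAt ?_
    exact fun s hs => mul_lt_mul_of_pos_left hs hD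
  tendsto_zero := by
    rw [show (0 : ℝ) = D * 0 by simp]
    refine Tendsto.const_mul _ (hφ.tendsto_zero.comp ?_)
    refine tendsto_nhdsWithin_iff.2 ⟨?_, ?_⟩
    · refine Tendsto.mono_left ?_ nhdsWithin_le_nhds
      have : Tendsto (fun t : ℝ => D * t) (𝓝 (D * 0)) (𝓝 (D * (D * 0))) :=
        (continuous_const.mul continuous_id).tendsto _
      simpa using this
    · filter_upwards [self_mem_nhdsWithin] with s hs
      have : (0:ℝ) < s := by simpa using hs
      exact mul_pos hD this
  nontrivial := by
    obtain ⟨t, ht, h⟩ := hφ.nontrivial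
    refine ⟨t / D, div_pos ht hD, mul_ne_zero hD.ne' ?_⟩
    rwa [mul_div_cancel₀ _ hD.ne']

end IsYoungDensity

lemma youngFun_dilate (φ : ℝ → ℝ) {D : ℝ} (t : ℝ) :
    youngFun (fun s => D * φ (D * s)) t = youngFun φ (D * t) := by
  unfold youngFun
  rw [intervalIntegral.integral_const_mul, intervalIntegral.mul_integral_comp_mul_left]
  simp

/-! ### Muckenhoupt's Hardy inequality for general measures -/

/-- A lower set with a maximum lies in one closed half-line; without a maximum it is covered by the
increasing countable family of half-lines with rational endpoint in S. -/
lemma measure_le_of_isLowerSet (m : Measure ℝ) {S : Set ℝ} (hS : IsLowerSet S) {τ : ℝ≥0∞}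
    (h : ∀ x ∈ S, m (Iic x) ≤ τ) : m S ≤ τ := by
  by_cases hmax : ∃ a ∈ S, ∀ x ∈ S, x ≤ a
  · obtain ⟨a, ha, hle⟩ := hmax
    exact (measure_mono hle).trans (h a ha)
  · push Not at hmax
    have hsub : S ⊆ ⋃ q : {q : ℚ // (q : ℝ) ∈ S}, Iic ((q : ℚ) : ℝ) := by
      intro x hx
      obtain ⟨y, hy, hxy⟩ := hmax x hx
      obtain ⟨q, hq1, hq2⟩ := exists_rat_btwn hxy
      exact mem_iUnion.2 ⟨⟨q, hS hq2.le hy⟩, hq1.le⟩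
    refine (measure_mono hsub).trans ?_
    rw [Monotone.measure_iUnion]
    · exact iSup_le fun q => h _ q.2
    · intro a b hab
      exact Iic_subset_Iic.2 (by exact_mod_cast hab)

lemma measure_le_of_isUpperSet (m : Measure ℝ) {S : Set ℝ} (hS : IsUpperSet S) {τ : ℝ≥0∞}
    (h : ∀ x ∈ S, m (Ici x) ≤ τ) : m S ≤ τ := by
  have key := measure_le_of_isLowerSet (m.map (MeasurableEquiv.neg ℝ)) (S := Neg.neg ⁻¹' S) (τ := τ)
    (fun a b hab ha => hS (neg_le_neg hab) ha) (fun x hx => by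
      rw [MeasurableEquiv.map_apply]
      have : (MeasurableEquiv.neg ℝ) ⁻¹' Iic x = Ici (-x) := by
        ext y; simp
      rw [this]
      exact h _ hx)
  rw [MeasurableEquiv.map_apply] at key
  have : (MeasurableEquiv.neg ℝ) ⁻¹' (Neg.neg ⁻¹' S) = S := by
    ext y; simp
  rwa [this] at key

/-- This replaces the substitution τ = m(Iic x), available for measures with a density. Atoms leave
only an inequality, which is enough for all the integrals of powers of m(Iic x) below. -/
lemma measure_Iic_lt_le (m : Measure ℝ) (τ : ℝ≥0∞) : m {x | m (Iic x) < τ} ≤ τ :=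
  measure_le_of_isLowerSet m
    (fun _ _ hab ha => (measure_mono (Iic_subset_Iic.2 hab)).trans_lt ha) fun _ hx => le_of_lt hx

lemma measure_Ici_lt_le (m : Measure ℝ) (τ : ℝ≥0∞) : m {x | m (Ici x) < τ} ≤ τ :=
  measure_le_of_isUpperSet m
    (fun _ _ hab ha => (measure_mono (Ici_subset_Ici.2 hab)).trans_lt ha) fun _ hx => le_of_lt hx

section LayerCake

variable {α : Type*} [MeasurableSpace α] {m : Measure α} {G : α → ℝ≥0∞}

lemma ae_ne_zero_of_measure_lt_le (hm : ∀ τ, m {x | G x < τ} ≤ τ) : ∀ᵐ x ∂m, G x ≠ 0 := by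
  rw [ae_iff]
  refine le_antisymm (le_of_forall_gt fun τ hτ => lt_of_le_of_lt ?_
    (ENNReal.half_lt_self (ne_of_gt (lt_min hτ one_pos))
      (ne_top_of_le_ne_top ENNReal.one_ne_top (min_le_right τ 1)) |>.trans_le (min_le_left _ _)))
    zero_le
  refine (measure_mono ?_).trans (hm _)
  intro x hx
  simp only [ne_eq, not_not, mem_ofPred_eq] at hx
  simp only [mem_ofPred_eq, hx]
  exact ENNReal.half_pos (ne_of_gt (lt_min hτ one_pos))

lemma measure_lt_inv_rpow_le (hm : ∀ τ, m {x | G x < τ} ≤ τ) {b t : ℝ} (hb : 0 < b) (ht : 0 < t) :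
    m {x | ENNReal.ofReal t < (G x)⁻¹ ^ b} ≤ ENNReal.ofReal (t ^ (-(1 / b))) := by
  refine (measure_mono ?_).trans (hm _)
  intro x hx
  simp only [mem_ofPred_eq] at hx ⊢
  rw [Real.rpow_neg ht.le, ENNReal.ofReal_inv_of_pos (by positivity), ENNReal.lt_inv_iff_lt_inv,
    ← ENNReal.ofReal_rpow_of_pos ht, one_div]
  rwa [ENNReal.rpow_inv_lt_iff hb]

lemma lintegral_inv_rpow_le (hG : Measurable G) (hm : ∀ τ, m {x | G x < τ} ≤ τ) {b : ℝ}
    (hb : 0 < b) :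
    ∫⁻ x, (G x)⁻¹ ^ b ∂m ≤ ∫⁻ t in Ioi (0 : ℝ), m {x | ENNReal.ofReal t < (G x)⁻¹ ^ b} := by
  have hae : (fun x => (G x)⁻¹ ^ b) =ᵐ[m] fun x => ENNReal.ofReal ((G x)⁻¹ ^ b).toReal := by
    filter_upwards [ae_ne_zero_of_measure_lt_le hm] with x hx
    rw [ENNReal.ofReal_toReal]
    exact ENNReal.rpow_ne_top_of_nonneg hb.le (ENNReal.inv_ne_top.2 hx)
  rw [lintegral_congr_ae hae, lintegral_eq_lintegral_meas_lt m
    (ae_of_all _ fun x => ENNReal.toReal_nonneg) (by fun_prop)]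
  refine setLIntegral_mono' measurableSet_Ioi fun t ht => measure_mono fun x hx => ?_
  simp only [mem_ofPred_eq] at hx ⊢
  exact ENNReal.ofReal_lt_iff_lt_toReal (le_of_lt ht) (fun h => by
    rw [h] at hx; simp at hx; exact absurd hx (not_lt.2 (le_of_lt ht))) |>.2 hx

/-- The level set at height t has measure at most min(M, t^{-1/a}) with M the total mass. The two
bounds cross at t = M^{-a}, and the second is integrable at infinity because 1/a > 1. -/
lemma lintegral_inv_rpow_le_of_lt_one (hG : Measurable G) (hm : ∀ τ, m {x | G x < τ} ≤ τ) {a : ℝ}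
    (ha : 0 < a) (ha1 : a < 1) :
    ∫⁻ x, (G x)⁻¹ ^ a ∂m ≤ ENNReal.ofReal (1 / (1 - a)) * m univ ^ (1 - a) := by
  have h1a : 0 < 1 - a := by linarith
  by_cases h0 : m univ = 0
  · rw [Measure.measure_univ_eq_zero] at h0
    simp [h0]
  by_cases htop : m univ = ∞
  · rw [htop, ENNReal.top_rpow_of_pos h1a, ENNReal.mul_top]
    · exact le_top
    · simpa using ha1
  set M := (m univ).toReal with hM
  have hM0 : 0 < M := ENNReal.toReal_pos h0 htop
  have hMe : m univ = ENNReal.ofReal M := (ENNReal.ofReal_toReal htop).symm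
  have hT : 0 < M ^ (-a) := by positivity
  have hexp : -(1 / a) < -1 := by
    rw [neg_lt_neg_iff]; exact (one_lt_div ha).2 ha1
  have hTe : M ^ (-a) * M = M ^ (1 - a) := by
    rw [← Real.rpow_add_one hM0.ne']; ring_nf
  refine (lintegral_inv_rpow_le hG hm ha).trans ?_
  rw [← Ioc_union_Ioi_eq_Ioi hT.le, lintegral_union measurableSet_Ioi Ioc_disjoint_Ioi_same]
  have hA : ∫⁻ t in Ioc 0 (M ^ (-a)), m {x | ENNReal.ofReal t < (G x)⁻¹ ^ a}
      ≤ ENNReal.ofReal (M ^ (1 - a)) := by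
    calc _ ≤ ∫⁻ t in Ioc 0 (M ^ (-a)), ENNReal.ofReal M :=
          lintegral_mono fun t => (measure_mono (subset_univ _)).trans_eq hMe
      _ = _ := by
          rw [setLIntegral_const, Real.volume_Ioc, sub_zero, ← ENNReal.ofReal_mul hM0.le, mul_comm,
            hTe]
  have hB : ∫⁻ t in Ioi (M ^ (-a)), m {x | ENNReal.ofReal t < (G x)⁻¹ ^ a}
      ≤ ENNReal.ofReal (M ^ (1 - a) * (a / (1 - a))) := by
    calc _ ≤ ∫⁻ t in Ioi (M ^ (-a)), ENNReal.ofReal (t ^ (-(1 / a))) :=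
          setLIntegral_mono' measurableSet_Ioi fun t ht =>
            measure_lt_inv_rpow_le hm ha (hT.trans ht)
      _ = ENNReal.ofReal (∫ t in Ioi (M ^ (-a)), t ^ (-(1 / a))) := by
          rw [ofReal_integral_eq_lintegral_ofReal (integrableOn_Ioi_rpow_of_lt hexp hT)]
          exact (ae_restrict_mem measurableSet_Ioi).mono fun t ht =>
            Real.rpow_nonneg (hT.trans ht).le _
      _ = _ := by
          rw [integral_Ioi_rpow_of_lt hexp hT, ← Real.rpow_mul hM0.le]
          congr 1
          have e : -a * (-(1 / a) + 1) = 1 - a := by field_simp; ring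
          have e2 : -(1 / a) + 1 = -((1 - a) / a) := by field_simp; ring
          rw [e, e2]; field_simp
  refine (add_le_add hA hB).trans_eq ?_
  rw [hMe, ENNReal.ofReal_rpow_of_pos hM0, ← ENNReal.ofReal_mul (by positivity),
    ← ENNReal.ofReal_add (by positivity) (by positivity)]
  congr 1
  field_simp
  ring

/-- Now t^{-1/b} is integrable at 0, and the lower bound on G makes the level sets above G₀^{-b}
null. -/
lemma lintegral_inv_rpow_le_of_one_lt (hG : Measurable G) (hm : ∀ τ, m {x | G x < τ} ≤ τ)
    {b G₀ : ℝ} (hb : 1 < b) (hG₀ : 0 < G₀) (hle : ∀ᵐ x ∂m, ENNReal.ofReal G₀ ≤ G x) :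
    ∫⁻ x, (G x)⁻¹ ^ b ∂m ≤ ENNReal.ofReal (b / (b - 1) * G₀ ^ (1 - b)) := by
  have hb0 : 0 < b := by linarith
  have hT : 0 < G₀ ^ (-b) := by positivity
  refine (lintegral_inv_rpow_le hG hm hb0).trans ?_
  rw [← Ioc_union_Ioi_eq_Ioi hT.le, lintegral_union measurableSet_Ioi Ioc_disjoint_Ioi_same]
  have hB : ∫⁻ t in Ioi (G₀ ^ (-b)), m {x | ENNReal.ofReal t < (G x)⁻¹ ^ b} = 0 := by
    rw [setLIntegral_eq_zero_iff' measurableSet_Ioi]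
    · refine ae_of_all _ fun t ht => ?_
      rw [← compl_compl {x | ENNReal.ofReal t < (G x)⁻¹ ^ b}]
      change _ ∈ ae m
      filter_upwards [hle] with x hx
      simp only [mem_compl_iff, mem_ofPred_eq, not_lt]
      refine (ENNReal.rpow_le_rpow (ENNReal.inv_le_inv.2 hx) hb0.le).trans ?_
      rw [← ENNReal.ofReal_inv_of_pos hG₀, ENNReal.ofReal_rpow_of_pos (by positivity),
        Real.inv_rpow hG₀.le, ← Real.rpow_neg hG₀.le]
      exact ENNReal.ofReal_le_ofReal (le_of_lt ht)
    · refine (Antitone.measurable fun s t hst => measure_mono fun x hx => ?_).aemeasurable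
      exact (ENNReal.ofReal_le_ofReal hst).trans_lt hx
  have hA : ∫⁻ t in Ioc 0 (G₀ ^ (-b)), m {x | ENNReal.ofReal t < (G x)⁻¹ ^ b}
      ≤ ENNReal.ofReal (b / (b - 1) * G₀ ^ (1 - b)) := by
    have hexp : -1 < -(1 / b) := by
      rw [neg_lt_neg_iff]; exact (div_lt_one hb0).2 hb
    calc _ ≤ ∫⁻ t in Ioc 0 (G₀ ^ (-b)), ENNReal.ofReal (t ^ (-(1 / b))) :=
          setLIntegral_mono' measurableSet_Ioc fun t ht => measure_lt_inv_rpow_le hm hb0 ht.1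
      _ = ENNReal.ofReal (∫ t in (0:ℝ)..(G₀ ^ (-b)), t ^ (-(1 / b))) := by
          rw [intervalIntegral.integral_of_le hT.le, ofReal_integral_eq_lintegral_ofReal]
          · exact (intervalIntegral.intervalIntegrable_rpow' hexp).1
          · exact (ae_restrict_mem measurableSet_Ioc).mono fun t ht => Real.rpow_nonneg ht.1.le _
      _ = _ := by
          have hb1 : 0 < b - 1 := by linarith
          have e2 : -(1 / b) + 1 = (b - 1) / b := by field_simp; ring
          have e : -b * ((b - 1) / b) = 1 - b := by field_simp; ring
          rw [integral_rpow (Or.inl hexp), e2, Real.zero_rpow (by positivity),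
            ← Real.rpow_mul hG₀.le, e]
          congr 1
          field_simp
          ring
  rw [hB, add_zero]
  exact hA

end LayerCake

/-- The two-weight Hardy inequality of Muckenhoupt, for arbitrary measures on the line. -/
theorem lintegral_rpow_lintegral_Ioi_le {q q' : ℝ} (hq : q.HolderConjugate q') (m₁ m₂ : Measure ℝ)
    [SFinite m₁] [SFinite m₂] {k : ℝ → ℝ≥0∞} (hk : Measurable k) {B : ℝ≥0∞} (hBtop : B ≠ ∞)
    (hB : ∀ x, m₂ (Ici x) ^ (1 / q') * m₁ (Iic x) ^ (1 / q) ≤ B) :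
    ∫⁻ x, (∫⁻ s in Ioi x, k s ∂m₂) ^ q ∂m₁ ≤
      (ENNReal.ofReal q' * B) ^ (q - 1) * (ENNReal.ofReal q * B) * ∫⁻ s, k s ^ q ∂m₂ := by
  have hq0 : 0 < q := hq.pos
  have hq'0 : 0 < q' := hq.symm.pos
  have hq1 : 1 < q := hq.lt
  have hq'1 : 1 < q' := hq.symm.lt
  have hsum : 1 / q + 1 / q' = 1 := by simpa using hq.inv_add_inv_eq_one
  set G₁ : ℝ → ℝ≥0∞ := fun x => m₁ (Iic x) with hG₁
  set G₂ : ℝ → ℝ≥0∞ := fun x => m₂ (Ici x) with hG₂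
  have hG₁m : Measurable G₁ :=
    Monotone.measurable fun a b hab => measure_mono (Iic_subset_Iic.2 hab)
  have hG₂m : Measurable G₂ :=
    Antitone.measurable fun a b hab => measure_mono (Ici_subset_Ici.2 hab)
  have h1 : ∀ τ, m₁ {x | G₁ x < τ} ≤ τ := measure_Iic_lt_le m₁
  have h2 : ∀ τ, m₂ {x | G₂ x < τ} ≤ τ := measure_Ici_lt_le m₂
  have hA1 : ∀ s, ∫⁻ x in Iio s, (G₁ x)⁻¹ ^ (1 / q') ∂m₁ ≤ ENNReal.ofReal q * G₁ s ^ (1 / q) := by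
    intro s
    refine (lintegral_inv_rpow_le_of_lt_one hG₁m
      (fun τ => (Measure.restrict_apply_le _ _).trans (h1 τ)) (a := 1 / q') (by positivity)
      ((div_lt_one hq'0).2 hq'1)).trans ?_
    rw [show 1 - 1 / q' = 1 / q by linarith, one_div_one_div]
    gcongr
    rw [Measure.restrict_apply_univ]
    exact measure_mono Iio_subset_Iic_self
  have hA2 : ∀ s, ∫⁻ x in Ioi s, (G₂ x)⁻¹ ^ (1 / q) ∂m₂ ≤ ENNReal.ofReal q' * G₂ s ^ (1 / q') := by
    intro s
    refine (lintegral_inv_rpow_le_of_lt_one hG₂m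
      (fun τ => (Measure.restrict_apply_le _ _).trans (h2 τ)) (a := 1 / q) (by positivity)
      ((div_lt_one hq0).2 hq1)).trans ?_
    rw [show 1 - 1 / q = 1 / q' by linarith, one_div_one_div]
    gcongr
    rw [Measure.restrict_apply_univ]
    exact measure_mono Ioi_subset_Ici_self
  set K : ℝ → ℝ≥0∞ := fun s => k s ^ q * G₂ s ^ (1 / q') with hK
  have hKm : Measurable K := by fun_prop
  -- Hölder after inserting G₂^{1/(qq')} and its inverse. The factor free of k is an integral of
  -- G₂^{-1/q}, bounded by q' G₂(x)^{1/q'}, and the hypothesis trades G₂(x)^{1/q'} for B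
  -- G₁(x)^{-1/q}.
  have hpt : ∀ᵐ x ∂m₁, (∫⁻ s in Ioi x, k s ∂m₂) ^ q ≤
      (ENNReal.ofReal q' * B) ^ (q - 1) * ((G₁ x)⁻¹ ^ (1 / q') * ∫⁻ s in Ioi x, K s ∂m₂) := by
    filter_upwards [ae_ne_zero_of_measure_lt_le h1] with x hx
    have hG₂x : G₂ x ≠ ∞ := by
      intro h
      have := hB x
      rw [show m₂ (Ici x) = ∞ from h, ENNReal.top_rpow_of_pos (by positivity), ENNReal.top_mul]
        at this
      · exact hBtop (top_le_iff.1 this)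
      · exact (ENNReal.rpow_pos_of_nonneg (pos_iff_ne_zero.2 hx) (by positivity)).ne'
    have hG₂le : G₂ x ^ (1 / q') ≤ B * (G₁ x)⁻¹ ^ (1 / q) := by
      rw [ENNReal.inv_rpow, ← div_eq_mul_inv]
      by_cases ht : G₁ x = ∞
      · have := hB x
        rw [show m₁ (Iic x) = ∞ from ht, ENNReal.top_rpow_of_pos (by positivity)] at this
        have h0 : G₂ x ^ (1 / q') = 0 := by
          by_contra hne
          rw [ENNReal.mul_top hne] at this
          exact hBtop (top_le_iff.1 this)
        rw [h0]; exact zero_le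
      · refine (ENNReal.le_div_iff_mul_le (Or.inl ?_) (Or.inl ?_)).2 (hB x)
        · exact (ENNReal.rpow_pos_of_nonneg (pos_iff_ne_zero.2 hx) (by positivity)).ne'
        · exact ENNReal.rpow_ne_top_of_nonneg (by positivity) ht
    have hle : ∫⁻ s in Ioi x, k s ∂m₂ ≤ ∫⁻ s in Ioi x,
        ((fun s => k s * G₂ s ^ (1 / q' / q)) * (fun s => (G₂ s)⁻¹ ^ (1 / q / q'))) s ∂m₂ := by
      refine lintegral_mono_ae ?_
      filter_upwards [ae_restrict_of_ae (ae_ne_zero_of_measure_lt_le h2),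
        ae_restrict_mem measurableSet_Ioi] with s hs hxs
      have hst : G₂ s ≠ ∞ :=
        ne_top_of_le_ne_top hG₂x (measure_mono (Ici_subset_Ici.2 (le_of_lt hxs)))
      simp only [Pi.mul_apply]
      rw [mul_assoc, ENNReal.inv_rpow, div_right_comm, ENNReal.mul_inv_cancel, mul_one]
      · exact (ENNReal.rpow_pos_of_nonneg (pos_iff_ne_zero.2 hs) (by positivity)).ne'
      · exact ENNReal.rpow_ne_top_of_nonneg (by positivity) hst
    have hH := hle.trans (ENNReal.lintegral_mul_le_Lp_mul_Lq (m₂.restrict (Ioi x)) hq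
      (by fun_prop) (by fun_prop))
    have e1 : ∀ s, (k s * G₂ s ^ (1 / q' / q)) ^ q = K s := by
      intro s
      rw [ENNReal.mul_rpow_of_nonneg _ _ hq0.le, ← ENNReal.rpow_mul, div_mul_cancel₀ _ hq0.ne']
    have e2 : ∀ s, ((G₂ s)⁻¹ ^ (1 / q / q')) ^ q' = (G₂ s)⁻¹ ^ (1 / q) := by
      intro s
      rw [← ENNReal.rpow_mul, div_mul_cancel₀ _ hq'0.ne']
    simp only [e1, e2] at hH
    have hqq : 1 / q' * q = q - 1 := by
      have : 1 / q' = 1 - 1 / q := by linarith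
      rw [this]; field_simp
    calc (∫⁻ s in Ioi x, k s ∂m₂) ^ q
        ≤ ((∫⁻ s in Ioi x, K s ∂m₂) ^ (1 / q) *
            (∫⁻ s in Ioi x, (G₂ s)⁻¹ ^ (1 / q) ∂m₂) ^ (1 / q')) ^ q :=
          ENNReal.rpow_le_rpow hH hq0.le
      _ = (∫⁻ s in Ioi x, K s ∂m₂) * (∫⁻ s in Ioi x, (G₂ s)⁻¹ ^ (1 / q) ∂m₂) ^ (q - 1) := by
          rw [ENNReal.mul_rpow_of_nonneg _ _ hq0.le, ← ENNReal.rpow_mul, ← ENNReal.rpow_mul,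
            one_div_mul_cancel hq0.ne', ENNReal.rpow_one, hqq]
      _ ≤ (∫⁻ s in Ioi x, K s ∂m₂) *
            (ENNReal.ofReal q' * (B * (G₁ x)⁻¹ ^ (1 / q))) ^ (q - 1) := by
          gcongr
          exact (hA2 x).trans (by gcongr)
      _ = _ := by
          rw [← mul_assoc (ENNReal.ofReal q'), ENNReal.mul_rpow_of_nonneg _ _ (by linarith),
            ← ENNReal.rpow_mul,
            show 1 / q * (q - 1) = 1 / q' by
              have : 1 / q' = 1 - 1 / q := by linarith
              rw [this]; field_simp]
          ring
  refine (lintegral_mono_ae hpt).trans ?_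
  rw [lintegral_const_mul _ (by
    refine Measurable.mul (by fun_prop) (Antitone.measurable fun a b hab => ?_)
    exact lintegral_mono_set (Ioi_subset_Ioi hab)), mul_assoc]
  gcongr
  -- Tonelli over {x < s}: the inner integral becomes one of G₁^{-1/q'} over (-∞, s), and a second
  -- use of the hypothesis removes the remaining powers of G₁ and G₂.
  have hswap : ∫⁻ x, (G₁ x)⁻¹ ^ (1 / q') * ∫⁻ s in Ioi x, K s ∂m₂ ∂m₁ =
      ∫⁻ s, K s * ∫⁻ x in Iio s, (G₁ x)⁻¹ ^ (1 / q') ∂m₁ ∂m₂ := by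
    have hmeas : Measurable (Function.uncurry fun x s : ℝ =>
        {z : ℝ × ℝ | z.1 < z.2}.indicator (fun z => (G₁ z.1)⁻¹ ^ (1 / q') * K z.2) (x, s)) := by
      refine Measurable.indicator ?_ (measurableSet_lt measurable_fst measurable_snd)
      fun_prop
    calc _ = ∫⁻ x, ∫⁻ s, {z : ℝ × ℝ | z.1 < z.2}.indicator
            (fun z => (G₁ z.1)⁻¹ ^ (1 / q') * K z.2) (x, s) ∂m₂ ∂m₁ := by
          refine lintegral_congr fun x => ?_
          rw [← lintegral_const_mul _ hKm, ← lintegral_indicator measurableSet_Ioi]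
          refine lintegral_congr fun s => ?_
          simp [indicator_apply]
      _ = ∫⁻ s, ∫⁻ x, {z : ℝ × ℝ | z.1 < z.2}.indicator
            (fun z => (G₁ z.1)⁻¹ ^ (1 / q') * K z.2) (x, s) ∂m₁ ∂m₂ :=
          lintegral_lintegral_swap hmeas.aemeasurable
      _ = _ := by
          refine lintegral_congr fun s => ?_
          rw [← lintegral_const_mul _ (by fun_prop), ← lintegral_indicator measurableSet_Iio]
          refine lintegral_congr fun x => ?_
          simp [indicator_apply, mul_comm]
  rw [hswap, ← lintegral_const_mul _ (by fun_prop)]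
  refine lintegral_mono fun s => ?_
  calc K s * ∫⁻ x in Iio s, (G₁ x)⁻¹ ^ (1 / q') ∂m₁
      ≤ (k s ^ q * G₂ s ^ (1 / q')) * (ENNReal.ofReal q * G₁ s ^ (1 / q)) := by
        gcongr
        exact hA1 s
    _ = ENNReal.ofReal q * (G₂ s ^ (1 / q') * G₁ s ^ (1 / q)) * k s ^ q := by ring
    _ ≤ ENNReal.ofReal q * B * k s ^ q := by gcongr; exact hB s

/-! ### The Hardy inequality for the weights of the Cianchi condition -/

namespace IsYoungDensity

variable {φ : ℝ → ℝ}

lemma measurable_indicator (hφ : IsYoungDensity φ) : Measurable ((Ioi (0 : ℝ)).indicator φ) := by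
  refine Monotone.measurable fun a b hab => ?_
  by_cases ha : 0 < a
  · have hb : 0 < b := ha.trans_le hab
    simpa [indicator_of_mem, ha, hb] using hφ.mono ha hb hab
  · rw [indicator_of_notMem (by simpa using ha)]
    exact indicator_nonneg (fun t ht => hφ.nonneg t ht) b

lemma youngFun_eq_zero_of_lintegral (hφ : IsYoungDensity φ) {p x : ℝ} (hx : 0 < x)
    (h : ∫⁻ y in Ioo 0 x, ENNReal.ofReal (φ y / y ^ p) = 0) : youngFun φ x = 0 := by
  have hm : AEMeasurable φ (volume.restrict (Ioo 0 x)) :=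
    hφ.aemeasurable_restrict_pos measurableSet_Ioo Ioo_subset_Ioi_self
  rw [lintegral_eq_zero_iff' (by fun_prop)] at h
  have h0 : φ =ᵐ[volume.restrict (Ioo 0 x)] 0 := by
    filter_upwards [h, ae_restrict_mem measurableSet_Ioo] with y hy hy'
    simp only [Pi.zero_apply, ENNReal.ofReal_eq_zero] at hy ⊢
    have hyp : 0 < y ^ p := Real.rpow_pos_of_pos hy'.1 p
    have := hφ.nonneg y hy'.1
    refine le_antisymm ?_ this
    by_contra! hc
    exact absurd hy (not_le.2 (div_pos hc hyp))
  rw [youngFun, intervalIntegral.integral_of_le hx.le, integral_Ioc_eq_integral_Ioo,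
    integral_congr_ae h0]
  simp

lemma exists_youngFun_eq (hφ : IsYoungDensity φ) {x ε : ℝ} (hx : 0 < x) (h : youngFun φ x = 0)
    (hε : 0 < ε) : ∃ a, x < a ∧ youngFun φ a = ε := by
  obtain ⟨t, ht, hlt⟩ := hφ.youngFun_unbounded ε
  have hxt : x < t := by
    by_contra! hc
    have := hφ.youngFun_mono (mem_Ici.2 ht.le) (mem_Ici.2 hx.le) hc
    linarith
  have hc : ContinuousOn (youngFun φ) (Icc x t) :=
    hφ.continuousOn_youngFun.mono fun s hs => hx.le.trans hs.1
  obtain ⟨a, ha, hae⟩ := intermediate_value_Icc hxt.le hc (show ε ∈ Icc _ _ by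
    rw [h]; exact ⟨hε.le, hlt.le⟩)
  refine ⟨a, lt_of_le_of_ne ha.1 ?_, hae⟩
  rintro rfl
  linarith

/-- In the variable τ = Φ(y) this is at least a multiple of ∫ τ^{-b} dτ near 0, divergent as b > 1.
Concretely, stopping where Φ = ε gives the lower bound ε^{1-b} x^c for every ε > 0. -/
lemma lintegral_div_rpow_eq_top (hφ : IsYoungDensity φ) {b c x : ℝ} (hb : 1 < b) (hc : 0 ≤ c)
    (hx : 0 < x) (h : youngFun φ x = 0) :
    ∫⁻ y in Ioi x, ENNReal.ofReal (φ y / youngFun φ y ^ b * y ^ c) = ∞ := by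
  have key : ∀ ε : ℝ, 0 < ε → ENNReal.ofReal (ε ^ (1 - b) * x ^ c) ≤
      ∫⁻ y in Ioi x, ENNReal.ofReal (φ y / youngFun φ y ^ b * y ^ c) := by
    intro ε hε
    obtain ⟨a, hxa, hae⟩ := hφ.exists_youngFun_eq hx h hε
    calc ENNReal.ofReal (ε ^ (1 - b) * x ^ c)
        = ENNReal.ofReal (youngFun φ a - youngFun φ x) * ENNReal.ofReal ((ε ^ b)⁻¹ * x ^ c) := by
          rw [hae, h, sub_zero, ← ENNReal.ofReal_mul hε.le, Real.rpow_sub hε, Real.rpow_one]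
          congr 1
          field_simp
      _ = ∫⁻ y in Ioc x a, ENNReal.ofReal (φ y) * ENNReal.ofReal ((ε ^ b)⁻¹ * x ^ c) := by
          rw [hφ.ofReal_youngFun_sub hx.le hxa.le, lintegral_mul_const']
          exact ENNReal.ofReal_ne_top
      _ ≤ ∫⁻ y in Ioc x a, ENNReal.ofReal (φ y / youngFun φ y ^ b * y ^ c) := by
          refine setLIntegral_mono' measurableSet_Ioc fun y hy => ?_
          have hy0 : 0 < y := hx.trans hy.1
          have hφy := hφ.nonneg y hy0
          rw [← ENNReal.ofReal_mul hφy]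
          refine ENNReal.ofReal_le_ofReal ?_
          rcases (hφ.youngFun_nonneg hy0.le).eq_or_lt with h0 | hpos
          · simp [hφ.density_eq_zero hy0 h0.symm]
          · have h1 : youngFun φ y ≤ ε := hae ▸ hφ.youngFun_mono (mem_Ici.2 hy0.le)
              (mem_Ici.2 (hx.trans hxa).le) hy.2
            rw [div_eq_mul_inv, mul_assoc]
            gcongr
            exact hy.1.le
      _ ≤ _ := lintegral_mono_set Ioc_subset_Ioi_self
  refine ENNReal.eq_top_of_forall_nnreal_le fun N => ?_
  have hxc : 0 < x ^ c := Real.rpow_pos_of_pos hx c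
  have hN : 0 < ((N : ℝ) + 1) / x ^ c := by positivity
  have h1b : 1 - b ≠ 0 := by linarith
  have := key ((((N : ℝ) + 1) / x ^ c) ^ (1 - b)⁻¹) (by positivity)
  rw [← Real.rpow_mul hN.le, inv_mul_cancel₀ h1b, Real.rpow_one, div_mul_cancel₀ _ hxc.ne'] at this
  refine le_trans ?_ this
  rw [← ENNReal.ofReal_coe_nnreal]
  exact ENNReal.ofReal_le_ofReal (by linarith)

end IsYoungDensity

/-- Pointwise bound behind the passage from the weight `φ ^ (1 - q')` to `φ / Φ ^ q'`. -/
lemma rpow_div_weight_mul_le {q q' r s a F : ℝ} (hq : q.HolderConjugate q') (hs : 0 < s)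
    (ha : 0 < a) (hF : 0 < F) (hFa : F ≤ s * a) :
    (s ^ (r - 1) / (a / F ^ q' * s ^ (r * q'))) ^ q * (a / F ^ q' * s ^ (r * q')) ≤ a := by
  have hq0 := hq.pos
  have hqq : q' * (q - 1) = q := by rw [mul_comm]; exact hq.sub_one_mul_conj
  set U := a / F ^ q' * s ^ (r * q') with hU
  have hU0 : 0 < U := by positivity
  have h1 : U ^ (q - 1) = a ^ (q - 1) / F ^ q * s ^ (r * q) := by
    rw [hU, Real.mul_rpow (by positivity) (by positivity), Real.div_rpow ha.le (by positivity),
      ← Real.rpow_mul hF.le, ← Real.rpow_mul hs.le, mul_assoc, hqq]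
  have h2 : (s ^ (r - 1) / U) ^ q * U = (s ^ (r - 1)) ^ q / U ^ (q - 1) := by
    rw [Real.div_rpow (by positivity) hU0.le, Real.rpow_sub_one hU0.ne']
    field_simp
  have h3 : a * a ^ (q - 1) = a ^ q := by rw [Real.rpow_sub_one ha.ne']; field_simp
  have h4 : (s ^ (r - 1)) ^ q * s ^ q = s ^ (r * q) := by
    rw [← Real.rpow_mul hs.le, ← Real.rpow_add hs]; ring_nf
  have h5 : F ^ q ≤ s ^ q * a ^ q := by
    rw [← Real.mul_rpow hs.le ha.le]; exact Real.rpow_le_rpow hF.le hFa hq0.le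
  rw [h2, h1, div_le_iff₀ (by positivity), ← mul_assoc, ← mul_div_assoc, h3, ← h4, div_mul_eq_mul_div,
    le_div_iff₀ (by positivity)]
  calc (s ^ (r - 1)) ^ q * F ^ q ≤ (s ^ (r - 1)) ^ q * (s ^ q * a ^ q) := by gcongr
    _ = _ := by ring

/-- With u the first weight in the condition and k = ρ^{1/q} s^{r-1} / u, one has k u = ρ^{1/q}
s^{r-1} and k^q u ≤ ρ φ₂ wherever Φ₂ > 0, so the general Hardy inequality applies to k. -/
lemma hardy_young {p r : ℝ} (hr : 1 ≤ r) (hrp : r < p) {φ₁ φ₂ : ℝ → ℝ} (hφ₁ : IsYoungDensity φ₁)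
    (hφ₂ : IsYoungDensity φ₂) {B : ℝ}
    (hB : ∀ x : ℝ, 0 < x →
      (∫⁻ y in Ioi x, ENNReal.ofReal (φ₂ y / youngFun φ₂ y ^ (Real.conjExponent (p / r)) *
          y ^ (r * Real.conjExponent (p / r)))) ^ (1 / Real.conjExponent (p / r)) *
      (∫⁻ y in Ioo 0 x, ENNReal.ofReal (φ₁ y / y ^ p)) ^ (1 / (p / r)) ≤ ENNReal.ofReal B) :
    ∃ A : ℝ, 0 < A ∧ ∀ ρ : ℝ → ℝ≥0∞, Measurable ρ →
      ∫⁻ l in Ioi (0 : ℝ), ENNReal.ofReal (φ₁ l / l ^ p) *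
        (∫⁻ s in Ioi l, ρ s ^ (r / p) * ENNReal.ofReal (s ^ (r - 1))) ^ (p / r) ≤
      ENNReal.ofReal A * ∫⁻ s in Ioi (0 : ℝ), ρ s * ENNReal.ofReal (φ₂ s) := by
  have hr0 : 0 < r := by linarith
  have hp0 : 0 < p := by linarith
  set q := p / r with hqdef
  set q' := Real.conjExponent q with hq'def
  have hq1 : 1 < q := (one_lt_div hr0).2 hrp
  have hq : q.HolderConjugate q' := Real.HolderConjugate.conjExponent hq1
  have hq0 : 0 < q := hq.pos
  have hq'0 : 0 < q' := hq.symm.pos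
  have hrpq : r / p = 1 / q := by rw [hqdef]; field_simp
  -- Where Φ₂ vanishes so does u, and dividing by u loses information. There the tail integral is
  -- infinite, so the condition forces the other factor, hence φ₁, to vanish.
  have hzero : ∀ x, 0 < x → youngFun φ₂ x = 0 → φ₁ x = 0 := by
    intro x hx h0
    have hV := hφ₂.lintegral_div_rpow_eq_top hq.symm.lt (c := r * q') (by positivity) hx h0
    have := hB x hx
    rw [hV, ENNReal.top_rpow_of_pos (by positivity)] at this
    refine hφ₁.density_eq_zero hx (hφ₁.youngFun_eq_zero_of_lintegral (p := p) hx ?_)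
    by_contra hne
    rw [ENNReal.top_mul] at this
    · exact ENNReal.ofReal_ne_top (top_le_iff.1 this)
    · exact (ENNReal.rpow_pos_of_nonneg (pos_iff_ne_zero.2 hne) (by positivity)).ne'
  set w : ℝ → ℝ≥0∞ := (Ioi (0 : ℝ)).indicator fun y => ENNReal.ofReal (φ₁ y / y ^ p) with hw
  set u : ℝ → ℝ≥0∞ := (Ioi (0 : ℝ)).indicator fun y =>
    ENNReal.ofReal (φ₂ y / youngFun φ₂ y ^ q' * y ^ (r * q')) with hu
  have hφ₁m := hφ₁.measurable_indicator
  have hφ₂m := hφ₂.measurable_indicator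
  have hΦm := hφ₂.measurable_youngFun_abs
  have hwm : Measurable w := by
    have : w = (Ioi (0 : ℝ)).indicator
        fun y => ENNReal.ofReal ((Ioi (0 : ℝ)).indicator φ₁ y / y ^ p) := by
      refine indicator_congr fun y hy => ?_
      rw [indicator_of_mem hy]
    rw [this]
    exact Measurable.indicator (by fun_prop) measurableSet_Ioi
  have hum : Measurable u := by
    have : u = (Ioi (0 : ℝ)).indicator fun y => ENNReal.ofReal
        ((Ioi (0 : ℝ)).indicator φ₂ y / youngFun φ₂ |y| ^ q' * y ^ (r * q')) := by
      refine indicator_congr fun y hy => ?_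
      rw [indicator_of_mem hy, abs_of_pos hy]
    rw [this]
    exact Measurable.indicator (by fun_prop) measurableSet_Ioi
  have hu_pos : ∀ s, 0 < s → 0 < youngFun φ₂ s → 0 < φ₂ s / youngFun φ₂ s ^ q' * s ^ (r * q') := by
    intro s hs h
    have := hφ₂.density_pos hs h
    positivity
  have hcond : ∀ x, (volume.withDensity u) (Ici x) ^ (1 / q') *
      (volume.withDensity w) (Iic x) ^ (1 / q) ≤ ENNReal.ofReal B := by
    intro x
    rw [withDensity_apply _ measurableSet_Ici, withDensity_apply _ measurableSet_Iic]
    by_cases hx : 0 < x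
    · refine le_trans (le_of_eq ?_) (hB x hx)
      congr 2
      · rw [setLIntegral_congr Ioi_ae_eq_Ici.symm]
        exact setLIntegral_congr_fun measurableSet_Ioi fun y hy =>
          indicator_of_mem (show y ∈ Ioi (0 : ℝ) from hx.trans hy) _
      · rw [setLIntegral_congr Iio_ae_eq_Iic.symm, hw, setLIntegral_indicator measurableSet_Ioi,
          Ioi_inter_Iio]
    · have : ∫⁻ y in Iic x, w y = 0 := by
        rw [hw, setLIntegral_indicator measurableSet_Ioi, Ioi_inter_Iic, Ioc_eq_empty hx]
        simp
      rw [this, ENNReal.zero_rpow_of_pos (by positivity), mul_zero]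
      exact zero_le
  set A := (ENNReal.ofReal q' * ENNReal.ofReal B) ^ (q - 1) *
    (ENNReal.ofReal q * ENNReal.ofReal B) with hA
  have hAtop : A ≠ ∞ := by
    refine ENNReal.mul_ne_top (ENNReal.rpow_ne_top_of_nonneg (by linarith) ?_) ?_ <;>
    exact ENNReal.mul_ne_top ENNReal.ofReal_ne_top ENNReal.ofReal_ne_top
  refine ⟨A.toReal + 1, by positivity, fun ρ hρ => ?_⟩
  set k : ℝ → ℝ≥0∞ := fun s => ρ s ^ (1 / q) * ENNReal.ofReal (s ^ (r - 1)) / u s with hk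
  have hkm : Measurable k := by fun_prop
  have hH := lintegral_rpow_lintegral_Ioi_le hq (volume.withDensity w) (volume.withDensity u) hkm
    ENNReal.ofReal_ne_top hcond
  rw [lintegral_withDensity_eq_lintegral_mul _ hwm (by
      refine Measurable.pow_const (Antitone.measurable fun a b hab => ?_) _
      exact lintegral_mono_set (Ioi_subset_Ioi hab)),
    lintegral_withDensity_eq_lintegral_mul _ hum (by fun_prop)] at hH
  have hL : ∫⁻ l in Ioi (0 : ℝ), ENNReal.ofReal (φ₁ l / l ^ p) *
        (∫⁻ s in Ioi l, ρ s ^ (r / p) * ENNReal.ofReal (s ^ (r - 1))) ^ q ≤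
      ∫⁻ x, (w * fun x => (∫⁻ s in Ioi x, k s ∂(volume.withDensity u)) ^ q) x := by
    rw [← lintegral_indicator measurableSet_Ioi]
    refine lintegral_mono fun x => ?_
    by_cases hx : x ∈ Ioi (0 : ℝ)
    · have hx' : 0 < x := hx
      simp only [hw, Pi.mul_apply, indicator_of_mem hx]
      rcases (hφ₂.youngFun_nonneg hx'.le).eq_or_lt with h0 | hpos
      · simp [hzero x hx h0.symm]
      · refine mul_le_mul' le_rfl (ENNReal.rpow_le_rpow ?_ hq0.le)
        rw [restrict_withDensity measurableSet_Ioi, lintegral_withDensity_eq_lintegral_mul _ hum hkm]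
        refine setLIntegral_mono' measurableSet_Ioi fun s hs => ?_
        have hs0 : 0 < s := hx'.trans hs
        have hFs : 0 < youngFun φ₂ s := hpos.trans_le (hφ₂.youngFun_mono (mem_Ici.2 hx'.le)
          (mem_Ici.2 hs0.le) (le_of_lt hs))
        simp only [hk, Pi.mul_apply, hrpq]
        rw [ENNReal.mul_div_cancel]
        · rw [hu, indicator_of_mem (show s ∈ Ioi (0 : ℝ) from hs0)]
          exact (ENNReal.ofReal_pos.2 (hu_pos s hs0 hFs)).ne'
        · rw [hu, indicator_of_mem (show s ∈ Ioi (0 : ℝ) from hs0)]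
          exact ENNReal.ofReal_ne_top
    · rw [indicator_of_notMem hx]; exact zero_le
  have hR : ∫⁻ x, (u * fun s => k s ^ q) x ≤ ∫⁻ s in Ioi (0 : ℝ), ρ s * ENNReal.ofReal (φ₂ s) := by
    rw [← lintegral_indicator measurableSet_Ioi]
    refine lintegral_mono fun s => ?_
    by_cases hs : s ∈ Ioi (0 : ℝ)
    · have hs0 : 0 < s := hs
      rcases (hφ₂.youngFun_nonneg hs0.le).eq_or_lt with h0 | hpos
      · simp only [hu, Pi.mul_apply, indicator_of_mem hs]
        simp [hφ₂.density_eq_zero hs0 h0.symm]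
      · have hus := hu_pos s hs0 hpos
        simp only [hk, hu, Pi.mul_apply, indicator_of_mem hs]
        rw [mul_div_assoc, ENNReal.mul_rpow_of_nonneg _ _ hq0.le, ← ENNReal.rpow_mul,
          one_div_mul_cancel hq0.ne', ENNReal.rpow_one, mul_left_comm]
        gcongr
        rw [← ENNReal.ofReal_div_of_pos hus, ENNReal.ofReal_rpow_of_nonneg (by positivity) hq0.le,
          ← ENNReal.ofReal_mul hus.le, mul_comm]
        exact ENNReal.ofReal_le_ofReal (rpow_div_weight_mul_le hq hs0 (hφ₂.density_pos hs0 hpos)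
          hpos (hφ₂.youngFun_le_mul hs0))
    · simp [hu, indicator_of_notMem hs]
  refine hL.trans (hH.trans ?_)
  gcongr
  rw [← hA]
  refine (ENNReal.le_ofReal_iff_toReal_le hAtop (by positivity)).2 (by linarith)

/-! ### Truncation, rearrangement and the Lorentz functional -/

section Truncation

variable {X : Type*} {f : X → ℝ}

/-- Truncation of `f` at the level `l`. -/
def truncAt (f : X → ℝ) (l : ℝ) (x : X) : ℝ := max (-l) (min (f x) l)

lemma abs_truncAt_le {l : ℝ} (hl : 0 ≤ l) (x : X) : |truncAt f l x| ≤ l := by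
  unfold truncAt
  exact abs_le.2 ⟨le_max_left _ _, max_le (by linarith) (min_le_right _ _)⟩

lemma add_lt_abs_of_lt_abs_sub_truncAt {l s : ℝ} (hs : 0 ≤ s) {x : X}
    (h : s < |f x - truncAt f l x|) : s + l < |f x| := by
  unfold truncAt at h
  rcases le_total (f x) l with h1 | h1
  · rw [min_eq_left h1] at h
    rcases le_total (-l) (f x) with h2 | h2
    · rw [max_eq_right h2, sub_self, abs_zero] at h; linarith
    · rw [max_eq_left h2, abs_of_nonpos (by linarith)] at h
      linarith [neg_le_abs (f x)]
  · rw [min_eq_right h1] at h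
    rcases le_total (-l) l with h2 | h2
    · rw [max_eq_right h2, abs_of_nonneg (by linarith)] at h
      linarith [le_abs_self (f x)]
    · rw [max_eq_left h2] at h
      rcases le_total (f x) (-l) with h3 | h3
      · rw [abs_of_nonpos (by linarith)] at h
        linarith [neg_le_abs (f x)]
      · rw [abs_of_nonneg (by linarith)] at h
        linarith [le_abs_self (f x)]

lemma truncAt_const_mul {L : ℝ} (hL : 0 < L) (g : X → ℝ) (l : ℝ) (x : X) :
    truncAt (fun x => L * g x) (L * l) x = L * truncAt g l x := by
  unfold truncAt
  rw [mul_max_of_nonneg _ _ hL.le, mul_min_of_nonneg _ _ hL.le, mul_neg]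

end Truncation

section Rearrangement

variable {X : Type*} [MeasurableSpace X] {μ : Measure X} {f : X → ℝ}

lemma antitone_distribFun (μ : Measure X) (f : X → ℝ) : Antitone (distribFun μ f) :=
  fun _ _ hst => measure_mono fun _ hx => lt_of_le_of_lt hst hx

lemma measurable_distribFun (μ : Measure X) (f : X → ℝ) : Measurable (distribFun μ f) :=
  (antitone_distribFun μ f).measurable

lemma decRearr_le {s t : ℝ} (hs : 0 < s) (h : distribFun μ f s ≤ ENNReal.ofReal t) :
    decRearr μ f t ≤ ENNReal.ofReal s :=
  iInf_le_of_le s (iInf₂_le hs h)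

lemma distribFun_le_of_decRearr_lt {s t : ℝ} (h : decRearr μ f t < ENNReal.ofReal s) :
    distribFun μ f s ≤ ENNReal.ofReal t := by
  simp only [decRearr, iInf_lt_iff] at h
  obtain ⟨s', hs', hd, hlt⟩ := h
  exact (antitone_distribFun μ f ((ENNReal.ofReal_lt_ofReal_iff'.1 hlt).1.le)).trans hd

lemma distribFun_eq_zero_of_eLpNorm_top_le {s : ℝ} (hs : 0 ≤ s) (h : eLpNorm f ∞ μ ≤ ENNReal.ofReal s) :
    distribFun μ f s = 0 := by
  rw [eLpNorm_exponent_top] at h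
  rw [distribFun, ← compl_compl {x | s < |f x|}]
  change _ ∈ ae μ
  filter_upwards [ae_le_eLpNormEssSup (f := f) (μ := μ)] with x hx
  simp only [mem_compl_iff, mem_ofPred_eq, not_lt]
  have := hx.trans h
  rwa [Real.enorm_eq_ofReal_abs, ENNReal.ofReal_le_ofReal_iff hs] at this

lemma lintegral_Ioi_comp_mul_left {L : ℝ} (hL : 0 < L) (F : ℝ → ℝ≥0∞) :
    ∫⁻ t in Ioi (0 : ℝ), F t = ENNReal.ofReal L * ∫⁻ t in Ioi (0 : ℝ), F (L * t) := by
  have h := Real.smul_map_volume_mul_left hL.ne'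
  rw [← lintegral_indicator measurableSet_Ioi, ← lintegral_indicator measurableSet_Ioi]
  conv_lhs => rw [← h]
  rw [lintegral_smul_measure, abs_of_pos hL, smul_eq_mul]
  congr 1
  have := lintegral_map_equiv (μ := volume) ((Ioi (0 : ℝ)).indicator F)
    (Homeomorph.mulLeft₀ L hL.ne').toMeasurableEquiv
  rw [show (⇑(Homeomorph.mulLeft₀ L hL.ne').toMeasurableEquiv : ℝ → ℝ) = fun x => L * x from rfl]
    at this
  rw [this]
  refine lintegral_congr fun t => ?_
  simp [indicator_apply, hL]

lemma lorentzNorm_const_mul {p r L : ℝ} (hr : 0 < r) (hL : 0 < L) (f : X → ℝ) :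
    lorentzNorm p r μ (fun x => L * f x) = ENNReal.ofReal L * lorentzNorm p r μ f := by
  have hd : ∀ t, distribFun μ (fun x => L * f x) (L * t) = distribFun μ f t := by
    intro t
    simp only [distribFun, abs_mul, abs_of_pos hL, mul_lt_mul_iff_right₀ hL]
  unfold lorentzNorm
  rw [lintegral_Ioi_comp_mul_left hL]
  have : ∫⁻ t in Ioi (0 : ℝ), distribFun μ (fun x => L * f x) (L * t) ^ (r / p) *
      ENNReal.ofReal ((L * t) ^ (r - 1)) = ENNReal.ofReal (L ^ (r - 1)) *
      ∫⁻ t in Ioi (0 : ℝ), distribFun μ f t ^ (r / p) * ENNReal.ofReal (t ^ (r - 1)) := by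
    rw [← lintegral_const_mul' _ _ ENNReal.ofReal_ne_top]
    refine setLIntegral_congr_fun measurableSet_Ioi fun t ht => ?_
    rw [hd, Real.mul_rpow hL.le (le_of_lt ht), ENNReal.ofReal_mul (by positivity)]
    ring
  rw [this, ← mul_assoc (ENNReal.ofReal L), ← ENNReal.ofReal_mul hL.le, ← Real.rpow_one_add' hL.le
    (by linarith), add_sub_cancel, mul_left_comm, ENNReal.mul_rpow_of_nonneg _ _ (by positivity),
    ENNReal.ofReal_rpow_of_pos (by positivity), ← Real.rpow_mul hL.le, mul_one_div_cancel hr.ne',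
    Real.rpow_one]

lemma measurable_truncAt (hf : Measurable f) (l : ℝ) : Measurable (truncAt f l) := by
  unfold truncAt; fun_prop

lemma eLpNorm_truncAt_le {l : ℝ} (hl : 0 ≤ l) : eLpNorm (truncAt f l) ∞ μ ≤ ENNReal.ofReal l := by
  rw [eLpNorm_exponent_top]
  refine eLpNormEssSup_le_of_ae_bound (ae_of_all _ fun x => ?_)
  exact abs_truncAt_le hl x

/-- Shift s to s + l: the remainder exceeds s only where |f| exceeds s + l, and s^{r-1} ≤ (s +
l)^{r-1} because r ≥ 1. -/
lemma lorentzNorm_sub_truncAt_rpow_le {p r l : ℝ} (hr : 1 ≤ r) (hp : 0 < p) (hl : 0 < l) :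
    lorentzNorm p r μ (f - truncAt f l) ^ p ≤ (ENNReal.ofReal r *
      ∫⁻ s in Ioi l, distribFun μ f s ^ (r / p) * ENNReal.ofReal (s ^ (r - 1))) ^ (p / r) := by
  have hr0 : 0 < r := by linarith
  unfold lorentzNorm
  rw [← ENNReal.rpow_mul, one_div_mul_eq_div]
  refine ENNReal.rpow_le_rpow (mul_le_mul' le_rfl ?_) (by positivity)
  set F : ℝ → ℝ≥0∞ := (Ioi l).indicator
    fun s => distribFun μ f s ^ (r / p) * ENNReal.ofReal (s ^ (r - 1)) with hF
  rw [← lintegral_indicator measurableSet_Ioi, ← lintegral_indicator measurableSet_Ioi, ← hF,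
    ← lintegral_add_right_eq_self F l]
  refine lintegral_mono fun s => ?_
  by_cases hs : s ∈ Ioi (0 : ℝ)
  · have hs0 : 0 < s := hs
    rw [hF, indicator_of_mem hs, indicator_of_mem (show s + l ∈ Ioi l by simpa using hs0)]
    refine mul_le_mul' (ENNReal.rpow_le_rpow (measure_mono fun x hx => ?_) (by positivity))
      (ENNReal.ofReal_le_ofReal (Real.rpow_le_rpow hs0.le (by linarith) (by linarith)))
    exact add_lt_abs_of_lt_abs_sub_truncAt hs0.le hx
  · rw [indicator_of_notMem hs]; exact zero_le

end Rearrangement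

/-! ### Distributional estimate for operators of class W -/

namespace InClassW

variable {X Y : Type*} [MeasurableSpace X] [MeasurableSpace Y] {p r : ℝ} {μ : Measure X}
  {ν : Measure Y} {𝓓 : Set (X → ℝ)} {T : (X → ℝ) → (Y → ℝ)}

lemma exists_distribFun_le (hT : InClassW p r μ ν 𝓓 T) (hp : 0 < p) :
    ∃ K A : ℝ, 0 < K ∧ 0 < A ∧ ∀ f ∈ 𝓓, ∀ l : ℝ, 0 < l → truncAt f l ∈ 𝓓 → f - truncAt f l ∈ 𝓓 →
      distribFun ν (T f) (K * l) ≤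
        ENNReal.ofReal A * (lorentzNorm p r μ (f - truncAt f l) / ENNReal.ofReal l) ^ p := by
  obtain ⟨C, c, hC, hc, hc1, hquasi⟩ := hT.quasilinear
  obtain ⟨M, hM, hweak⟩ := hT.weakType
  obtain ⟨N, hN, hbdd⟩ := hT.bounded
  -- At argument ct the two rearrangements are at most M l and N l. The factor 2 supplies the strict
  -- inequality needed to return to distribution functions; 1/c undoes the dilation of the argument.
  refine ⟨2 * (C * (M + N)), 1 / c, by positivity, by positivity, fun f hf l hl h2 h1 => ?_⟩
  set Q := (lorentzNorm p r μ (f - truncAt f l) / ENNReal.ofReal l) ^ p with hQ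
  refine le_of_forall_gt_imp_ge_of_dense fun b hb => ?_
  by_cases hbt : b = ∞
  · rw [hbt]; exact le_top
  have hb0 : 0 < b := lt_of_le_of_lt zero_le hb
  set t := b.toReal with htd
  have ht : 0 < t := ENNReal.toReal_pos hb0.ne' hbt
  have hbe : b = ENNReal.ofReal t := (ENNReal.ofReal_toReal hbt).symm
  rw [hbe] at hb ⊢
  have hQt : Q ≤ ENNReal.ofReal (c * t) := by
    have h := mul_le_mul' (le_refl (ENNReal.ofReal c)) hb.le
    rwa [← mul_assoc, ← ENNReal.ofReal_mul hc.le, mul_one_div_cancel hc.ne', ENNReal.ofReal_one,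
      one_mul, ← ENNReal.ofReal_mul hc.le] at h
  have hd1 : decRearr ν (T (f - truncAt f l)) (c * t) ≤ ENNReal.ofReal (M * l) := by
    refine decRearr_le (by positivity) (le_trans ?_ hQt)
    have hw := hweak _ h1 (M * l) (by positivity)
    rw [ENNReal.ofReal_mul hM.le, mul_assoc, ENNReal.mul_le_mul_iff_right
      (ENNReal.ofReal_pos.2 hM).ne' ENNReal.ofReal_ne_top, mul_comm,
      ← ENNReal.le_div_iff_mul_le (Or.inl (ENNReal.ofReal_pos.2 hl).ne')
        (Or.inl ENNReal.ofReal_ne_top)] at hw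
    have := ENNReal.rpow_le_rpow hw hp.le
    rwa [← ENNReal.rpow_mul, one_div_mul_cancel hp.ne', ENNReal.rpow_one] at this
  have hd2 : decRearr ν (T (truncAt f l)) (c * t) ≤ ENNReal.ofReal (N * l) := by
    refine decRearr_le (by positivity) ?_
    rw [distribFun_eq_zero_of_eLpNorm_top_le (by positivity)]
    · exact zero_le
    · rw [ENNReal.ofReal_mul hN.le]
      exact (hbdd _ h2).trans (mul_le_mul' le_rfl (eLpNorm_truncAt_le hl.le))
  have hq := hquasi _ h1 _ h2 t ht
  rw [sub_add_cancel] at hq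
  refine distribFun_le_of_decRearr_lt (lt_of_le_of_lt
    (hq.trans (mul_le_mul' le_rfl (add_le_add hd1 hd2))) ?_)
  rw [← ENNReal.ofReal_add (by positivity) (by positivity), ← ENNReal.ofReal_mul hC.le]
  refine (ENNReal.ofReal_lt_ofReal_iff (by positivity)).2 ?_
  have : 0 < C * (M * l + N * l) := by positivity
  linarith

end InClassW

/-! ### The Cianchi condition implies boundedness -/

section Sufficiency

variable {X Y : Type*} [MeasurableSpace X] [MeasurableSpace Y] {p r : ℝ} {μ : Measure X}
  {ν : Measure Y} {φ₁ φ₂ : ℝ → ℝ}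

lemma le_mul_gaugeNorm {Φ : ℝ → ℝ} {f : X → ℝ} {C : ℝ} {a : ℝ≥0∞} (hC : 0 < C)
    (h : ∀ L : ℝ, 0 < L → ∫⁻ x, ENNReal.ofReal (Φ (|f x| / L)) ∂μ ≤ 1 → a ≤ ENNReal.ofReal (C * L)) :
    a ≤ ENNReal.ofReal C * gaugeNorm Φ μ f := by
  rw [mul_comm, ← ENNReal.div_le_iff_le_mul (Or.inl (ENNReal.ofReal_pos.2 hC).ne')
    (Or.inl ENNReal.ofReal_ne_top)]
  refine le_iInf fun L => le_iInf₂ fun hL hi => ?_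
  rw [ENNReal.div_le_iff_le_mul (Or.inl (ENNReal.ofReal_pos.2 hC).ne')
    (Or.inl ENNReal.ofReal_ne_top), mul_comm, ← ENNReal.ofReal_mul hC.le]
  exact h L hL hi

/-- The Cianchi condition with `D = 1` and constant `B`. -/
def CianchiBound (p r : ℝ) (φ₁ φ₂ : ℝ → ℝ) (B : ℝ) : Prop :=
  ∀ x : ℝ, 0 < x →
    (∫⁻ y in Ioi x, ENNReal.ofReal (φ₂ y / youngFun φ₂ y ^ (Real.conjExponent (p / r)) *
        y ^ (r * Real.conjExponent (p / r)))) ^ (1 / Real.conjExponent (p / r)) *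
      (∫⁻ y in Ioo 0 x, ENNReal.ofReal (φ₁ y / y ^ p)) ^ (1 / (p / r)) ≤ ENNReal.ofReal B

lemma CianchiCondition.exists_cianchiBound (hr : 0 < r) (hrp : r < p)
    (h : CianchiCondition p r φ₁ φ₂) :
    ∃ B D : ℝ, 0 < D ∧ CianchiBound p r φ₁ (fun t => D * φ₂ (D * t)) B := by
  obtain ⟨B, D, hB, hD, h⟩ := h
  have hq := Real.HolderConjugate.conjExponent ((one_lt_div hr).2 hrp)
  set q' := Real.conjExponent (p / r)
  have hq'0 : 0 < q' := hq.symm.pos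
  refine ⟨D ^ (1 / q') * B, D, hD, fun x hx => ?_⟩
  have e : ∫⁻ y in Ioi x, ENNReal.ofReal
      (D * φ₂ (D * y) / youngFun (fun t => D * φ₂ (D * t)) y ^ q' * y ^ (r * q')) =
      ENNReal.ofReal D * ∫⁻ y in Ioi x, ENNReal.ofReal
        (φ₂ (D * y) / youngFun φ₂ (D * y) ^ q' * y ^ (r * q')) := by
    rw [← lintegral_const_mul' _ _ ENNReal.ofReal_ne_top]
    refine lintegral_congr fun y => ?_
    rw [← ENNReal.ofReal_mul hD.le, youngFun_dilate, mul_div_assoc, mul_assoc]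
  rw [e, ENNReal.mul_rpow_of_nonneg _ _ (by positivity), ENNReal.ofReal_rpow_of_pos hD, mul_assoc,
    ENNReal.ofReal_mul (by positivity)]
  exact mul_le_mul' le_rfl (h x hx)

lemma InClassW.exists_gaugeNorm_le {𝓓 : Set (X → ℝ)} {T : (X → ℝ) → (Y → ℝ)}
    (hT : InClassW p r μ ν 𝓓 T) (hr : 1 ≤ r) (hrp : r < p) (hφ₁ : IsYoungDensity φ₁)
    (hφ₂ : IsYoungDensity φ₂) {B : ℝ} (hB : CianchiBound p r φ₁ φ₂ B) :
    ∃ C : ℝ, 0 < C ∧ ∀ f ∈ 𝓓, Measurable f →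
      (∀ l, 0 < l → truncAt f l ∈ 𝓓 ∧ f - truncAt f l ∈ 𝓓) → ∀ L : ℝ, 0 < L →
      ∫⁻ x, ENNReal.ofReal (youngFun φ₂ (|f x| / L)) ∂μ ≤ 1 →
      gaugeNorm (youngFun φ₁) ν (T f) ≤ ENNReal.ofReal (C * L) := by
  have hr0 : 0 < r := by linarith
  have hp0 : 0 < p := by linarith
  obtain ⟨K, A, hK, hA, hdist⟩ := hT.exists_distribFun_le hp0
  obtain ⟨A₂, hA₂, hhardy⟩ := hardy_young hr hrp hφ₁ hφ₂ hB
  set R := A * r ^ (p / r) * A₂ with hR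
  have hR0 : 0 < R := by positivity
  -- The modular of Tf/(KL) is at most R; dividing further by E ≥ 1 brings it below 1 by convexity
  -- of Φ₁.
  set E := max 1 R with hE
  have hE1 : 1 ≤ E := le_max_left _ _
  have hE0 : 0 < E := by linarith
  refine ⟨E * K, by positivity, fun f hf hfm htr L hL hint => ?_⟩
  have hKL : 0 < K * L := by positivity
  set g : X → ℝ := fun x => f x / L with hg
  have hgm : Measurable g := hfm.div_const L
  have hfg : f = fun x => L * g x := by
    ext x; simp only [hg]; field_simp
  have hTm : Measurable (T f) := hT.measurable f hf
  have hpt : ∀ s ∈ Ioi (0 : ℝ), distribFun ν (fun y => T f y / (K * L)) s * ENNReal.ofReal (φ₁ s) ≤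
      ENNReal.ofReal (A * r ^ (p / r)) * (ENNReal.ofReal (φ₁ s / s ^ p) *
        (∫⁻ t in Ioi s, distribFun μ g t ^ (r / p) * ENNReal.ofReal (t ^ (r - 1))) ^ (p / r)) := by
    intro s hs
    have hs0 : 0 < s := hs
    have hLs : 0 < L * s := by positivity
    have h1 : distribFun ν (fun y => T f y / (K * L)) s = distribFun ν (T f) (K * (L * s)) := by
      simp only [distribFun, abs_div, abs_of_pos hKL, lt_div_iff₀ hKL]
      congr 2
      ext y
      rw [show s * (K * L) = K * (L * s) by ring]
    have h2 : f - truncAt f (L * s) = fun x => L * (g - truncAt g s) x := by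
      ext x
      have := truncAt_const_mul hL g s x
      rw [← hfg] at this
      simp only [Pi.sub_apply, this, mul_sub]
      rw [hfg]
    have h3 := hdist f hf (L * s) hLs (htr _ hLs).1 (htr _ hLs).2
    rw [h2, lorentzNorm_const_mul hr0 hL, ENNReal.ofReal_mul hL.le, ENNReal.mul_div_mul_left _ _
      (ENNReal.ofReal_pos.2 hL).ne' ENNReal.ofReal_ne_top,
      ENNReal.div_rpow_of_nonneg _ _ hp0.le, ENNReal.ofReal_rpow_of_pos hs0] at h3
    have h4 := lorentzNorm_sub_truncAt_rpow_le (μ := μ) (f := g) hr hp0 hs0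
    rw [ENNReal.mul_rpow_of_nonneg _ _ (by positivity), ENNReal.ofReal_rpow_of_pos hr0] at h4
    have hsp : 0 < s ^ p := by positivity
    rw [h1, ENNReal.ofReal_div_of_pos hsp, ENNReal.ofReal_mul hA.le]
    refine (mul_le_mul' (h3.trans (mul_le_mul' le_rfl (ENNReal.div_le_div_right h4 _))) le_rfl).trans
      (le_of_eq ?_)
    simp only [div_eq_mul_inv]
    ring
  have hmain : ∫⁻ y, ENNReal.ofReal (youngFun φ₁ |T f y / (K * L)|) ∂ν ≤ ENNReal.ofReal E := by
    rw [hφ₁.lintegral_youngFun ν (hTm.div_const _)]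
    refine (setLIntegral_mono' measurableSet_Ioi hpt).trans ?_
    rw [lintegral_const_mul' _ _ ENNReal.ofReal_ne_top]
    refine (mul_le_mul' le_rfl (hhardy _ (measurable_distribFun μ g))).trans ?_
    rw [← hφ₂.lintegral_youngFun μ hgm, ← mul_assoc, ← ENNReal.ofReal_mul (by positivity), ← hR]
    have : ∫⁻ x, ENNReal.ofReal (youngFun φ₂ |g x|) ∂μ ≤ 1 := by
      simpa only [hg, abs_div, abs_of_pos hL] using hint
    calc _ ≤ ENNReal.ofReal R * 1 := mul_le_mul' le_rfl this
      _ ≤ _ := by rw [mul_one]; exact ENNReal.ofReal_le_ofReal (le_max_right _ _)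
  refine iInf_le_of_le (E * K * L) (iInf₂_le (by positivity) ?_)
  calc ∫⁻ y, ENNReal.ofReal (youngFun φ₁ (|T f y| / (E * K * L))) ∂ν
      ≤ ∫⁻ y, ENNReal.ofReal E⁻¹ * ENNReal.ofReal (youngFun φ₁ |T f y / (K * L)|) ∂ν := by
        refine lintegral_mono fun y => ?_
        rw [← ENNReal.ofReal_mul (by positivity)]
        refine ENNReal.ofReal_le_ofReal ?_
        have := hφ₁.youngFun_div_le (t := |T f y / (K * L)|) (abs_nonneg _) hE1
        rw [abs_div, abs_of_pos hKL, div_div, show K * L * E = E * K * L by ring] at this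
        rw [abs_div, abs_of_pos hKL, inv_mul_eq_div]
        exact this
    _ ≤ ENNReal.ofReal E⁻¹ * ENNReal.ofReal E := by
        rw [lintegral_const_mul' _ _ ENNReal.ofReal_ne_top]
        exact mul_le_mul' le_rfl hmain
    _ = 1 := by
        rw [← ENNReal.ofReal_mul (by positivity), inv_mul_cancel₀ hE0.ne', ENNReal.ofReal_one]

/-- Hardy's inequality makes an integral in l finite, so its integrand is finite for almost every l.
Some such l lies where φ₁ > 0, and there the inner integral, hence the Lorentz functional of the
remainder, is finite. -/
lemma exists_lorentzNorm_sub_truncAt_lt_top (hr : 1 ≤ r) (hrp : r < p) (hφ₁ : IsYoungDensity φ₁)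
    (hφ₂ : IsYoungDensity φ₂) {B : ℝ} (hB : CianchiBound p r φ₁ φ₂ B) {f : X → ℝ}
    (hf : Measurable f) (hint : ∫⁻ x, ENNReal.ofReal (youngFun φ₂ |f x|) ∂μ < ∞) :
    ∃ l : ℝ, 0 < l ∧ lorentzNorm p r μ (f - truncAt f l) < ∞ := by
  have hr0 : 0 < r := by linarith
  have hp0 : 0 < p := by linarith
  obtain ⟨A, hA, hhardy⟩ := hardy_young hr hrp hφ₁ hφ₂ hB
  have h := hhardy _ (measurable_distribFun μ f)
  rw [← hφ₂.lintegral_youngFun μ hf] at h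
  have hfin := h.trans_lt (ENNReal.mul_lt_top ENNReal.ofReal_lt_top hint)
  obtain ⟨t, ht, hφt⟩ := hφ₁.exists_pos
  have hφm : AEMeasurable φ₁ (volume.restrict (Ioi 0)) :=
    hφ₁.aemeasurable_restrict_pos measurableSet_Ioi le_rfl
  have hae := ae_lt_top' (by
    refine AEMeasurable.mul (by fun_prop) (Measurable.aemeasurable ?_)
    refine Measurable.pow_const (Antitone.measurable fun a b hab => ?_) _
    exact lintegral_mono_set (Ioi_subset_Ioi hab)) hfin.ne
  have hne : (volume.restrict (Ioi (0 : ℝ))) (Ioo t (t + 1)) ≠ 0 := by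
    rw [Measure.restrict_apply measurableSet_Ioo, inter_eq_self_of_subset_left
      (show Ioo t (t + 1) ⊆ Ioi 0 from fun s hs => ht.trans hs.1)]
    simp
  obtain ⟨l, hl, hlt⟩ := Frequently.exists (p := fun l => l ∈ Ioo t (t + 1) ∧ _)
    ((frequently_ae_mem_iff.2 hne).and_eventually hae)
  have hl0 : 0 < l := ht.trans hl.1
  refine ⟨l, hl0, ?_⟩
  have hφl : 0 < φ₁ l := hφt.trans_le (hφ₁.mono ht hl0 hl.1.le)
  have hH : (∫⁻ s in Ioi l, distribFun μ f s ^ (r / p) * ENNReal.ofReal (s ^ (r - 1))) ^ (p / r)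
      < ∞ := by
    refine ENNReal.lt_top_of_mul_ne_top_right hlt.ne ?_
    exact (ENNReal.ofReal_pos.2 (by positivity)).ne'
  have := lorentzNorm_sub_truncAt_rpow_le (μ := μ) (f := f) hr hp0 hl0
  rw [ENNReal.mul_rpow_of_nonneg _ _ (by positivity)] at this
  have h2 := this.trans_lt (ENNReal.mul_lt_top (ENNReal.rpow_lt_top_of_nonneg (by positivity)
    ENNReal.ofReal_ne_top) hH)
  by_contra htop
  rw [not_lt, top_le_iff] at htop
  rw [htop, ENNReal.top_rpow_of_pos hp0] at h2
  exact lt_irrefl _ h2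

lemma truncAt_mem_simpleFunctions {f : X → ℝ} (hf : f ∈ simpleFunctions X) (l : ℝ) :
    truncAt f l ∈ simpleFunctions X ∧ f - truncAt f l ∈ simpleFunctions X := by
  refine ⟨⟨measurable_truncAt hf.1 l, ?_⟩, ⟨hf.1.sub (measurable_truncAt hf.1 l), ?_⟩⟩
  · refine (hf.2.image fun y => max (-l) (min y l)).subset ?_
    rintro _ ⟨x, rfl⟩
    exact ⟨f x, ⟨x, rfl⟩, rfl⟩
  · refine (hf.2.image fun y => y - max (-l) (min y l)).subset ?_
    rintro _ ⟨x, rfl⟩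
    exact ⟨f x, ⟨x, rfl⟩, rfl⟩

lemma lorentzNorm_zero (hr : 0 < r) (hp : 0 < p) : lorentzNorm p r μ (0 : X → ℝ) = 0 := by
  have : ∫⁻ t in Ioi (0 : ℝ), distribFun μ (0 : X → ℝ) t ^ (r / p) * ENNReal.ofReal (t ^ (r - 1))
      = 0 := by
    rw [← lintegral_zero (μ := volume.restrict (Ioi (0 : ℝ)))]
    refine setLIntegral_congr_fun measurableSet_Ioi fun t ht => ?_
    have ht0 : ¬ t < 0 := not_lt.2 (le_of_lt ht)
    simp [distribFun, ht0, ENNReal.zero_rpow_of_pos (div_pos hr hp)]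
  rw [lorentzNorm, this, mul_zero, ENNReal.zero_rpow_of_pos (by positivity)]

lemma truncAt_mem_lorentzAddLinfty (hr : 0 < r) (hp : 0 < p) {f : X → ℝ}
    (hf : f ∈ lorentzAddLinfty p r μ) {l : ℝ} (hl : 0 < l) :
    truncAt f l ∈ lorentzAddLinfty p r μ ∧ f - truncAt f l ∈ lorentzAddLinfty p r μ := by
  obtain ⟨g, h, hg, hh, hgn, hhn, rfl⟩ := hf
  have hm := measurable_truncAt (hg.add hh) l
  have hb : eLpNorm (truncAt (g + h) l) ∞ μ < ∞ :=
    (eLpNorm_truncAt_le hl.le).trans_lt ENNReal.ofReal_lt_top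
  refine ⟨⟨0, _, measurable_zero, hm, ?_, hb, (zero_add _).symm⟩,
    ⟨g, h - truncAt (g + h) l, hg, hh.sub hm, hgn, ?_, by abel⟩⟩
  · rw [lorentzNorm_zero hr hp]; exact ENNReal.zero_lt_top
  · exact (eLpNorm_sub_le hh.aestronglyMeasurable hm.aestronglyMeasurable (by simp)).trans_lt
      (ENNReal.add_lt_top.2 ⟨hhn, hb⟩)

lemma lintegral_dilate_div {D L : ℝ} (hD : 0 < D) (f : X → ℝ) :
    ∫⁻ x, ENNReal.ofReal (youngFun (fun t => D * φ₂ (D * t)) (|f x| / (D * L))) ∂μ =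
      ∫⁻ x, ENNReal.ofReal (youngFun φ₂ (|f x| / L)) ∂μ := by
  refine lintegral_congr fun x => ?_
  rw [youngFun_dilate, show D * (|f x| / (D * L)) = |f x| / L by field_simp]

theorem CianchiCondition.boundedOnSimple (hr : 1 ≤ r) (hrp : r < p) (hφ₁ : IsYoungDensity φ₁)
    (hφ₂ : IsYoungDensity φ₂) (h : CianchiCondition p r φ₁ φ₂) :
    BoundedOnSimple p r μ ν (youngFun φ₁) (youngFun φ₂) := by
  intro T hT
  obtain ⟨B, D, hD, hB⟩ := h.exists_cianchiBound (by linarith) hrp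
  obtain ⟨C, hC, hgauge⟩ := hT.exists_gaugeNorm_le hr hrp hφ₁ (hφ₂.dilate hD) hB
  refine ⟨C * D, by positivity, fun f hf _ => le_mul_gaugeNorm (by positivity) fun L hL hint => ?_⟩
  rw [mul_assoc]
  refine hgauge f hf hf.1 (fun l _ => truncAt_mem_simpleFunctions hf l) _ (by positivity) ?_
  rwa [lintegral_dilate_div hD]

theorem CianchiCondition.boundedOnOrlicz (hr : 1 ≤ r) (hrp : r < p) (hφ₁ : IsYoungDensity φ₁)
    (hφ₂ : IsYoungDensity φ₂) (h : CianchiCondition p r φ₁ φ₂) :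
    BoundedOnOrlicz p r μ ν (youngFun φ₁) (youngFun φ₂) := by
  intro T hT
  have hr0 : 0 < r := by linarith
  have hp0 : 0 < p := by linarith
  obtain ⟨B, D, hD, hB⟩ := h.exists_cianchiBound hr0 hrp
  obtain ⟨C, hC, hgauge⟩ := hT.exists_gaugeNorm_le hr hrp hφ₁ (hφ₂.dilate hD) hB
  refine ⟨C * D, by positivity, fun f hf => ?_⟩
  have hmem : f ∈ lorentzAddLinfty p r μ := by
    obtain ⟨hfm, k, hk, hint⟩ := hf
    set g : X → ℝ := fun x => k / D * f x with hg
    have hgm : Measurable g := hfm.const_mul _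
    have hkD : 0 < k / D := by positivity
    obtain ⟨l, hl, hlt⟩ := exists_lorentzNorm_sub_truncAt_lt_top (μ := μ) hr hrp hφ₁
      (hφ₂.dilate hD) hB hgm (by
        refine lt_of_eq_of_lt (lintegral_congr fun x => ?_) hint
        rw [youngFun_dilate, hg]
        simp only [abs_mul, abs_of_pos hkD]
        congr 2
        field_simp)
    have hDk : 0 < D / k := by positivity
    refine ⟨fun x => D / k * (g - truncAt g l) x, fun x => D / k * truncAt g l x,
      (hgm.sub (measurable_truncAt hgm l)).const_mul _, (measurable_truncAt hgm l).const_mul _,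
      ?_, ?_, ?_⟩
    · rw [lorentzNorm_const_mul hr0 hDk]
      exact ENNReal.mul_lt_top ENNReal.ofReal_lt_top hlt
    · rw [eLpNorm_exponent_top]
      refine (eLpNormEssSup_le_of_ae_bound (C := D / k * l) (ae_of_all _ fun x => ?_)).trans_lt
        ENNReal.ofReal_lt_top
      rw [Real.norm_eq_abs, abs_mul, abs_of_pos hDk]
      exact mul_le_mul_of_nonneg_left (abs_truncAt_le hl.le x) hDk.le
    · ext x
      simp only [Pi.add_apply, Pi.sub_apply, hg]
      field_simp
      ring
  refine ⟨hmem, le_mul_gaugeNorm (by positivity) fun L hL hint => ?_⟩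
  rw [mul_assoc]
  refine hgauge f hmem hf.1 (fun l hl => truncAt_mem_lorentzAddLinfty hr0 hp0 hmem hl) _
    (by positivity) ?_
  rwa [lintegral_dilate_div hD]

end Sufficiency

/-! ### Nonatomic measures -/

namespace IsNonatomic

variable {X : Type*} [MeasurableSpace X] {μ : Measure X}

/-- Of the two pieces B and A \ B, both of positive measure, one has at most half of the total. -/
lemma exists_subset_measure_le_half (hμ : IsNonatomic μ) {A : Set X} (hA : MeasurableSet A)
    (h0 : 0 < μ A) :
    ∃ C ⊆ A, MeasurableSet C ∧ 0 < μ C ∧ μ C ≤ μ A * 2⁻¹ := by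
  obtain ⟨B, hBA, hB, hB0, hlt⟩ := hμ A hA h0
  have hBtop : μ B ≠ ∞ := hlt.ne_top
  have hadd : μ B + μ (A \ B) = μ A := by
    rw [measure_add_sdiff hB.nullMeasurableSet, union_eq_self_of_subset_left hBA]
  by_cases h : μ B ≤ μ A * 2⁻¹
  · exact ⟨B, hBA, hB, hB0, h⟩
  · refine ⟨A \ B, sdiff_subset, hA.diff hB, ?_, ?_⟩
    · rw [pos_iff_ne_zero]
      intro hz
      rw [hz, add_zero] at hadd
      exact hlt.ne hadd
    · by_contra! hc
      push Not at h
      have := ENNReal.add_lt_add h hc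
      rw [hadd, ← mul_add, ENNReal.inv_two_add_inv_two, mul_one] at this
      exact lt_irrefl _ this

lemma exists_subset_measure_le (hμ : IsNonatomic μ) {A : Set X} (hA : MeasurableSet A)
    (h0 : 0 < μ A) (htop : μ A ≠ ∞) {ε : ℝ≥0∞} (hε : ε ≠ 0) :
    ∃ C ⊆ A, MeasurableSet C ∧ 0 < μ C ∧ μ C ≤ ε := by
  have key : ∀ n : ℕ, ∃ C ⊆ A, MeasurableSet C ∧ 0 < μ C ∧ μ C ≤ μ A * 2⁻¹ ^ n := by
    intro n
    induction n with
    | zero => exact ⟨A, le_rfl, hA, h0, by simp⟩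
    | succ n ih =>
      obtain ⟨C, hCA, hC, hC0, hle⟩ := ih
      obtain ⟨E, hEC, hE, hE0, hEle⟩ := hμ.exists_subset_measure_le_half hC hC0
      refine ⟨E, hEC.trans hCA, hE, hE0, hEle.trans ?_⟩
      rw [pow_succ, ← mul_assoc]
      gcongr
  obtain ⟨n, hn⟩ := ENNReal.exists_inv_two_pow_lt (a := ε / μ A) (ENNReal.div_pos hε htop).ne'
  obtain ⟨C, hCA, hC, hC0, hle⟩ := key n
  refine ⟨C, hCA, hC, hC0, hle.trans ?_⟩
  rw [mul_comm]
  exact (ENNReal.le_div_iff_mul_le (Or.inl h0.ne') (Or.inl htop)).1 hn.le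

/-- Sierpiński's theorem: a nonatomic measure takes all intermediate values. -/
theorem exists_subset_measure_eq (hμ : IsNonatomic μ) {A : Set X} (hA : MeasurableSet A)
    (htop : μ A ≠ ∞) {a : ℝ≥0∞} (ha : a ≤ μ A) : ∃ B ⊆ A, MeasurableSet B ∧ μ B = a := by
  have hatop : a ≠ ∞ := ne_top_of_le_ne_top htop ha
  let S := {B : Set X // MeasurableSet B ∧ B ⊆ A ∧ μ B ≤ a}
  -- Greedy choice: adjoin an admissible set whose measure exceeds half the supremum of those
  -- available.
  have step : ∀ B : S, ∃ V : S, B.1 ⊆ V.1 ∧ ∀ C ⊆ A \ B.1, MeasurableSet C → μ B.1 + μ C ≤ a →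
      μ B.1 + μ C * 2⁻¹ ≤ μ V.1 := by
    rintro ⟨B, hB, hBA, hBa⟩
    set s : ℝ≥0∞ := ⨆ (C : Set X) (_ : C ⊆ A \ B ∧ MeasurableSet C ∧ μ B + μ C ≤ a), μ C with hs
    have hsle : s ≤ a := iSup₂_le fun C hC => le_add_self.trans hC.2.2
    by_cases hs0 : s = 0
    · refine ⟨⟨B, hB, hBA, hBa⟩, le_rfl, fun C hC hCm hCa => ?_⟩
      have : μ C ≤ s := le_iSup₂_of_le C ⟨hC, hCm, hCa⟩ le_rfl
      rw [hs0, nonpos_iff_eq_zero] at this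
      simp [this]
    · have hlt : s * 2⁻¹ < s := by
        rw [← div_eq_mul_inv]
        exact ENNReal.half_lt_self hs0 (ne_top_of_le_ne_top hatop hsle)
      obtain ⟨E, hE⟩ := lt_iSup_iff.1 (lt_of_lt_of_eq hlt hs)
      obtain ⟨⟨hEA, hEm, hEa⟩, hlt'⟩ := lt_iSup_iff.1 hE
      have hmeas : μ (B ∪ E) = μ B + μ E :=
        measure_union (disjoint_sdiff_right.mono_right hEA) hEm
      refine ⟨⟨B ∪ E, hB.union hEm, union_subset hBA (hEA.trans sdiff_subset), hmeas.trans_le hEa⟩,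
        subset_union_left, fun C hC hCm hCa => ?_⟩
      simp only [hmeas]
      have : μ C ≤ s := le_iSup₂_of_le C ⟨hC, hCm, hCa⟩ le_rfl
      gcongr
      exact (mul_le_mul' this le_rfl).trans hlt'.le
  choose F hFsub hF using step
  let U : ℕ → S := fun n => Nat.rec ⟨∅, MeasurableSet.empty, empty_subset _, by simp⟩
    (fun _ B => F B) n
  have hUs : ∀ n, U (n + 1) = F (U n) := fun n => rfl
  have hmono : Monotone fun n => (U n).1 := monotone_nat_of_le_succ fun n => hFsub (U n)
  have hle : μ (⋃ n, (U n).1) ≤ a := by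
    rw [hmono.measure_iUnion]
    exact iSup_le fun n => (U n).2.2.2
  have hm : MeasurableSet (⋃ n, (U n).1) := MeasurableSet.iUnion fun n => (U n).2.1
  have hsub : (⋃ n, (U n).1) ⊆ A := iUnion_subset fun n => (U n).2.2.1
  refine ⟨_, hsub, hm, hle.antisymm ?_⟩
  by_contra! hlt
  have hpos : 0 < μ (A \ ⋃ n, (U n).1) :=
    (tsub_pos_of_lt (hlt.trans_le ha)).trans_le le_measure_sdiff
  obtain ⟨C, hCA, hC, hC0, hCle⟩ := hμ.exists_subset_measure_le (hA.diff hm) hpos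
    (measure_ne_top_of_subset sdiff_subset htop) (tsub_pos_of_lt hlt).ne'
  have hgrow : ∀ n : ℕ, n * (μ C * 2⁻¹) ≤ μ (U n).1 := by
    intro n
    induction n with
    | zero => simp
    | succ n ih =>
      rw [hUs]
      refine le_trans ?_ (hF (U n) C (hCA.trans (sdiff_subset_sdiff_right (subset_iUnion_of_subset n le_rfl)))
        hC ?_)
      · push_cast
        rw [add_mul, one_mul]
        gcongr
      · calc μ (U n).1 + μ C ≤ μ (⋃ n, (U n).1) + (a - μ (⋃ n, (U n).1)) :=
              add_le_add (measure_mono (subset_iUnion (fun n => (U n).1) n)) hCle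
          _ = a := add_tsub_cancel_of_le hle
  obtain ⟨n, hn⟩ := ENNReal.exists_nat_mul_gt (a := μ C * 2⁻¹)
    (mul_ne_zero hC0.ne' (by simp)) hatop
  exact absurd ((hgrow n).trans (U n).2.2.2) (not_le.2 hn)

/-- In an infinite nonatomic space there are disjoint sets with arbitrary prescribed measures. -/
theorem exists_pairwise_disjoint [SigmaFinite μ] (hμ : IsNonatomic μ) (hinf : μ univ = ∞)
    {ι : Type*} [Countable ι] (a : ι → ℝ≥0∞) (ha : ∀ i, a i ≠ ∞) :
    ∃ A : ι → Set X, (∀ i, MeasurableSet (A i)) ∧ (∀ i, μ (A i) = a i) ∧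
      Pairwise (Function.onFun Disjoint A) := by
  let S := {B : Set X // MeasurableSet B ∧ μ B ≠ ∞}
  have step : ∀ (b : {b : ℝ≥0∞ // b ≠ ∞}) (B : S), ∃ V : S, B.1 ⊆ V.1 ∧ μ (V.1 \ B.1) = b.1 := by
    rintro ⟨b, hb⟩ ⟨B, hB, hBtop⟩
    have hc : μ Bᶜ = ∞ := by
      by_contra hne
      have := measure_add_measure_compl (μ := μ) hB
      rw [hinf] at this
      exact ENNReal.add_ne_top.2 ⟨hBtop, hne⟩ this
    obtain ⟨t, ht, htB, hbt, httop⟩ := Measure.exists_subset_measure_lt_top hB.compl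
      (hc ▸ hb.lt_top : b < μ Bᶜ)
    obtain ⟨C, hCt, hC, hCb⟩ := hμ.exists_subset_measure_eq ht httop.ne hbt.le
    refine ⟨⟨B ∪ C, hB.union hC, ?_⟩, subset_union_left, ?_⟩
    · exact (measure_union_lt_top hBtop.lt_top (hCb ▸ hb.lt_top)).ne
    · simp only
      rw [union_sdiff_left, sdiff_eq_self_iff_disjoint.2 _, hCb]
      exact (disjoint_compl_right.mono_right (hCt.trans htB))
  choose F hFsub hF using step
  have hnat : ∀ b : ℕ → {b : ℝ≥0∞ // b ≠ ∞}, ∃ A : ℕ → Set X, (∀ i, MeasurableSet (A i)) ∧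
      (∀ i, μ (A i) = (b i).1) ∧ Pairwise (Function.onFun Disjoint A) := by
    intro b
    let U : ℕ → S := fun n => Nat.rec ⟨∅, MeasurableSet.empty, by simp⟩ (fun n B => F (b n) B) n
    have hmono : Monotone fun n => (U n).1 := monotone_nat_of_le_succ fun n => hFsub (b n) (U n)
    refine ⟨fun n => (U (n + 1)).1 \ (U n).1, fun n => (U (n + 1)).2.1.diff (U n).2.1,
      fun n => hF (b n) (U n), ?_⟩
    rw [pairwise_disjoint_on]
    intro m n hmn
    exact disjoint_sdiff_right.mono_left (sdiff_subset.trans (hmono hmn))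
  obtain ⟨e, he⟩ := Countable.exists_injective_nat ι
  obtain ⟨A, hA, hAb, hd⟩ := hnat fun n => by
    classical exact if h : ∃ i, e i = n then ⟨a h.choose, ha _⟩ else ⟨0, ENNReal.zero_ne_top⟩
  refine ⟨fun i => A (e i), fun i => hA _, fun i => ?_, fun i j hij => hd (he.ne hij)⟩
  have h : ∃ j, e j = e i := ⟨i, rfl⟩
  simp only [hAb, dif_pos h, he h.choose_spec]

/-- A function whose distribution is comparable to Lebesgue measure on `(0, ∞)`. -/
theorem exists_measure_le_comparable [SigmaFinite μ] (hμ : IsNonatomic μ) (hinf : μ univ = ∞) :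
    ∃ ψ : X → ℝ≥0∞, Measurable ψ ∧ (∀ x, ψ x ≠ 0) ∧ ∀ t : ℝ, 0 < t →
      ENNReal.ofReal (t / 4) ≤ μ {x | ψ x ≤ ENNReal.ofReal t} ∧
      μ {x | ψ x ≤ ENNReal.ofReal t} ≤ ENNReal.ofReal t := by
  classical
  obtain ⟨A, hA, hAμ, hd⟩ := hμ.exists_pairwise_disjoint hinf
    (fun k : ℤ => ENNReal.ofReal ((2 : ℝ) ^ k)) fun _ => ENNReal.ofReal_ne_top
  -- The set A k of measure 2^k imitates the interval [2^k, 2^(k+1)), and ψ is its right endpoint; ψ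
  -- is ∞ off all the A k.
  set ψ : X → ℝ≥0∞ := fun x => ⨅ k : ℤ, if x ∈ A k then ENNReal.ofReal ((2 : ℝ) ^ (k + 1)) else ∞
    with hψ
  have hval : ∀ k, ∀ x ∈ A k, ψ x = ENNReal.ofReal ((2 : ℝ) ^ (k + 1)) := by
    intro k x hx
    refine le_antisymm (iInf_le_of_le k (by rw [if_pos hx])) (le_iInf fun j => ?_)
    by_cases hj : x ∈ A j
    · have : j = k := by
        by_contra hne
        exact (disjoint_left.1 (hd hne)) hj hx
      rw [if_pos hj, this]
    · rw [if_neg hj]; exact le_top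
  have htop : ∀ x, (∀ k, x ∉ A k) → ψ x = ∞ := by
    intro x hx
    simp [hψ, hx]
  have hlevel : ∀ t : ℝ, 0 < t → {x | ψ x ≤ ENNReal.ofReal t} =
      ⋃ k : {k : ℤ // (2 : ℝ) ^ (k + 1) ≤ t}, A k := by
    intro t ht
    ext x
    simp only [mem_ofPred_eq, mem_iUnion]
    constructor
    · intro hx
      by_cases h : ∃ k, x ∈ A k
      · obtain ⟨k, hk⟩ := h
        rw [hval k x hk, ENNReal.ofReal_le_ofReal_iff ht.le] at hx
        exact ⟨⟨k, hx⟩, hk⟩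
      · push Not at h
        rw [htop x h] at hx
        exact absurd (top_le_iff.1 hx) ENNReal.ofReal_ne_top
    · rintro ⟨⟨k, hk⟩, hx⟩
      rw [hval k x hx]
      exact ENNReal.ofReal_le_ofReal hk
  refine ⟨ψ, Measurable.iInf fun k => Measurable.ite (hA k) measurable_const measurable_const,
    fun x => ?_, fun t ht => ⟨?_, ?_⟩⟩
  · by_cases h : ∃ k, x ∈ A k
    · obtain ⟨k, hk⟩ := h
      rw [hval k x hk]
      exact (ENNReal.ofReal_pos.2 (by positivity)).ne'
    · push Not at h
      rw [htop x h]
      exact ENNReal.top_ne_zero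
  -- With 2^k ≤ t/2 < 2^(k+1), the set A k alone lies in the level set and has measure above t/4.
  · obtain ⟨k, hk1, hk2⟩ := exists_mem_Ico_zpow (x := t / 2) (y := (2 : ℝ)) (by positivity)
      one_lt_two
    rw [zpow_add_one₀ two_ne_zero] at hk2
    calc ENNReal.ofReal (t / 4) ≤ μ (A k) := by
          rw [hAμ]; exact ENNReal.ofReal_le_ofReal (by linarith)
      _ ≤ _ := by
          rw [hlevel t ht]
          refine measure_mono (subset_iUnion (fun k : {k : ℤ // (2 : ℝ) ^ (k + 1) ≤ t} => A k) ⟨k, ?_⟩)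
          rw [zpow_add_one₀ two_ne_zero]; linarith
  · rw [hlevel t ht]
    refine (measure_iUnion_le _).trans ?_
    have hv : ∀ k : ℤ, μ (A k) = volume (Ico ((2 : ℝ) ^ k) (2 ^ (k + 1))) := by
      intro k
      rw [hAμ, Real.volume_Ico, zpow_add_one₀ two_ne_zero]
      congr 1; ring
    simp only [hv]
    have hdis : Pairwise (Function.onFun Disjoint fun k : ℤ => Ico ((2 : ℝ) ^ k) (2 ^ (k + 1))) :=
      (zpow_right_mono₀ one_le_two).pairwise_disjoint_on_Ico_succ
    have hdis' : Pairwise (Function.onFun Disjoint fun k : {k : ℤ // (2 : ℝ) ^ (k + 1) ≤ t} =>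
        Ico ((2 : ℝ) ^ k.1) (2 ^ (k.1 + 1))) :=
      fun i j hij => hdis (fun h => hij (Subtype.ext h))
    rw [← measure_iUnion hdis' fun _ => measurableSet_Ico]
    refine (measure_mono (iUnion_subset fun k => ?_)).trans_eq
      ((Real.volume_Ioc (a := 0) (b := t)).trans (by rw [sub_zero]))
    exact fun y hy => ⟨lt_of_lt_of_le (by positivity) hy.1, hy.2.le.trans k.2⟩

end IsNonatomic

/-! ### The Calderón operator: class W and lower bounds -/

section Calderon

variable {X Y : Type*} [MeasurableSpace X] [MeasurableSpace Y] {p r : ℝ} {μ : Measure X}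
  {ν : Measure Y} {f : X → ℝ}

/-- The Calderón maximal function `t ↦ t ^ (-1/p) ‖f* χ_(0,t)‖_{p,r}`, written in terms of the
distribution function of `f`. -/
noncomputable def calderonFun (p r : ℝ) (μ : Measure X) (f : X → ℝ) (t : ℝ≥0∞) : ℝ≥0∞ :=
  (ENNReal.ofReal r * ∫⁻ s in Ioi (0 : ℝ),
    min (distribFun μ f s / t) 1 ^ (r / p) * ENNReal.ofReal (s ^ (r - 1))) ^ (1 / r)

/-- The Calderón maximal function transported to `Y`. -/
noncomputable def calderonOp (p r : ℝ) (μ : Measure X) (ψ : Y → ℝ≥0∞) (f : X → ℝ) (y : Y) : ℝ :=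
  (calderonFun p r μ f (ψ y)).toReal

lemma antitone_calderonFun (hr : 0 < r) (hp : 0 < p) (f : X → ℝ) :
    Antitone (calderonFun p r μ f) := by
  intro a b hab
  unfold calderonFun
  gcongr

lemma lintegral_rpow_sub_one {a b : ℝ} (hr : 0 < r) (ha : 0 ≤ a) (hab : a ≤ b) :
    ENNReal.ofReal r * ∫⁻ s in Ioc a b, ENNReal.ofReal (s ^ (r - 1)) =
      ENNReal.ofReal (b ^ r - a ^ r) := by
  rw [← ofReal_integral_eq_lintegral_ofReal, ← intervalIntegral.integral_of_le hab,
    integral_rpow (Or.inl (by linarith)), ← ENNReal.ofReal_mul hr.le, sub_add_cancel,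
    mul_div_cancel₀ _ hr.ne']
  · exact (intervalIntegral.intervalIntegrable_rpow' (by linarith)).1
  · exact (ae_restrict_mem measurableSet_Ioc).mono fun s hs =>
      Real.rpow_nonneg (ha.trans hs.1.le) _

lemma lintegral_div_rpow (hr : 0 < r) (hp : 0 < p) (f : X → ℝ) (t : ℝ≥0∞) :
    (ENNReal.ofReal r * ∫⁻ s in Ioi (0 : ℝ),
      (distribFun μ f s / t) ^ (r / p) * ENNReal.ofReal (s ^ (r - 1))) ^ (1 / r) =
      lorentzNorm p r μ f / t ^ (1 / p) := by
  have hd := measurable_distribFun μ f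
  have h : ∫⁻ s in Ioi (0 : ℝ), (distribFun μ f s / t) ^ (r / p) * ENNReal.ofReal (s ^ (r - 1)) =
      (∫⁻ s in Ioi (0 : ℝ), distribFun μ f s ^ (r / p) * ENNReal.ofReal (s ^ (r - 1))) *
        (t ^ (r / p))⁻¹ := by
    rw [← lintegral_mul_const _ (by fun_prop)]
    refine lintegral_congr fun s => ?_
    rw [ENNReal.div_rpow_of_nonneg _ _ (by positivity), div_eq_mul_inv]
    ring
  rw [h, ← mul_assoc, ENNReal.mul_rpow_of_nonneg _ _ (by positivity), lorentzNorm, ENNReal.inv_rpow,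
    ← ENNReal.rpow_mul, div_mul_div_comm, mul_one, mul_comm p r, div_mul_cancel_left₀ hr.ne',
    one_div, one_div, div_eq_mul_inv, div_eq_mul_inv]

lemma calderonFun_le_lorentzNorm (hr : 0 < r) (hp : 0 < p) (f : X → ℝ) (t : ℝ≥0∞) :
    calderonFun p r μ f t ≤ lorentzNorm p r μ f / t ^ (1 / p) := by
  rw [← lintegral_div_rpow hr hp]
  unfold calderonFun
  gcongr
  exact min_le_left _ _

lemma calderonFun_le_eLpNorm (hr : 0 < r) (hp : 0 < p) (f : X → ℝ) (t : ℝ≥0∞) :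
    calderonFun p r μ f t ≤ eLpNorm f ∞ μ := by
  by_cases htop : eLpNorm f ∞ μ = ∞
  · rw [htop]; exact le_top
  set m := (eLpNorm f ∞ μ).toReal with hm
  have hme : eLpNorm f ∞ μ = ENNReal.ofReal m := (ENNReal.ofReal_toReal htop).symm
  have hm0 : 0 ≤ m := ENNReal.toReal_nonneg
  have h : ∫⁻ s in Ioi (0 : ℝ), min (distribFun μ f s / t) 1 ^ (r / p) *
      ENNReal.ofReal (s ^ (r - 1)) ≤ ∫⁻ s in Ioc 0 m, ENNReal.ofReal (s ^ (r - 1)) := by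
    rw [← lintegral_indicator measurableSet_Ioi, ← lintegral_indicator measurableSet_Ioc]
    refine lintegral_mono fun s => ?_
    by_cases hs : s ∈ Ioi (0 : ℝ)
    · rw [indicator_of_mem hs]
      rcases le_or_gt s m with hsm | hsm
      · rw [indicator_of_mem (show s ∈ Ioc 0 m from ⟨hs, hsm⟩)]
        exact mul_le_of_le_one_left' (ENNReal.rpow_le_one (min_le_right _ _) (by positivity))
      · rw [distribFun_eq_zero_of_eLpNorm_top_le (le_of_lt hs)
          (hme.trans_le (ENNReal.ofReal_le_ofReal hsm.le))]
        simp [ENNReal.zero_rpow_of_pos (div_pos hr hp)]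
    · rw [indicator_of_notMem hs]; exact zero_le
  unfold calderonFun
  calc _ ≤ (ENNReal.ofReal r * ∫⁻ s in Ioc 0 m, ENNReal.ofReal (s ^ (r - 1))) ^ (1 / r) := by gcongr
    _ = _ := by
      rw [lintegral_rpow_sub_one hr le_rfl hm0, Real.zero_rpow hr.ne', sub_zero,
        ENNReal.ofReal_rpow_of_nonneg (by positivity) (by positivity), ← Real.rpow_mul hm0,
        mul_one_div_cancel hr.ne', Real.rpow_one, hme]

lemma distribFun_add_le (f g : X → ℝ) (s : ℝ) :
    distribFun μ (f + g) (2 * s) ≤ distribFun μ f s + distribFun μ g s := by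
  refine (measure_mono fun x hx => ?_).trans (measure_union_le _ _)
  simp only [mem_ofPred_eq, Pi.add_apply, mem_union] at hx ⊢
  by_contra! h
  linarith [abs_add_le (f x) (g x)]

/-- The powers r/p and 1/r are subadditive since both exponents are at most 1. The factor 2 comes
from μ_{f+g}(2s) ≤ μ_f(s) + μ_g(s) after rescaling s. -/
lemma calderonFun_add_le (hr : 1 ≤ r) (hrp : r < p) (f g : X → ℝ) (t : ℝ≥0∞) :
    calderonFun p r μ (f + g) t ≤ 2 * (calderonFun p r μ f t + calderonFun p r μ g t) := by
  have hr0 : 0 < r := by linarith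
  have hp0 : 0 < p := by linarith
  have hdf := measurable_distribFun μ f
  have hdg := measurable_distribFun μ g
  set I : (X → ℝ) → ℝ≥0∞ := fun f => ENNReal.ofReal r * ∫⁻ s in Ioi (0 : ℝ),
    min (distribFun μ f s / t) 1 ^ (r / p) * ENNReal.ofReal (s ^ (r - 1)) with hI
  have key : I (f + g) ≤ ENNReal.ofReal (2 ^ r) * (I f + I g) := by
    simp only [hI]
    rw [lintegral_Ioi_comp_mul_left two_pos, ← mul_add, ← lintegral_add_left (by fun_prop)]
    have : ∫⁻ s in Ioi (0 : ℝ), min (distribFun μ (f + g) (2 * s) / t) 1 ^ (r / p) *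
          ENNReal.ofReal ((2 * s) ^ (r - 1)) ≤ ENNReal.ofReal (2 ^ (r - 1)) *
        ∫⁻ s in Ioi (0 : ℝ), (min (distribFun μ f s / t) 1 ^ (r / p) * ENNReal.ofReal (s ^ (r - 1)) +
          min (distribFun μ g s / t) 1 ^ (r / p) * ENNReal.ofReal (s ^ (r - 1))) := by
      rw [← lintegral_const_mul' _ _ ENNReal.ofReal_ne_top]
      refine setLIntegral_mono' measurableSet_Ioi fun s hs => ?_
      have hs0 : 0 < s := hs
      rw [Real.mul_rpow two_pos.le hs0.le, ENNReal.ofReal_mul (by positivity), ← add_mul,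
        mul_left_comm]
      gcongr
      refine le_trans ?_ (ENNReal.rpow_add_le_add_rpow _ _ (by positivity)
        ((div_le_one hp0).2 hrp.le))
      gcongr
      rcases le_or_gt (distribFun μ f s / t) 1 with h1 | h1
      · rcases le_or_gt (distribFun μ g s / t) 1 with h2 | h2
        · rw [min_eq_left h1, min_eq_left h2, ← ENNReal.add_div]
          exact (min_le_left _ _).trans (ENNReal.div_le_div_right (distribFun_add_le f g s) _)
        · rw [min_eq_right h2.le]
          exact (min_le_right _ _).trans le_add_self
      · rw [min_eq_right h1.le]
        exact (min_le_right _ _).trans le_self_add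
    refine (mul_le_mul' le_rfl (mul_le_mul' le_rfl this)).trans (le_of_eq ?_)
    rw [← mul_assoc (ENNReal.ofReal 2), ← ENNReal.ofReal_mul two_pos.le,
      ← Real.rpow_one_add' two_pos.le (by linarith), add_sub_cancel, mul_left_comm]
  calc calderonFun p r μ (f + g) t = I (f + g) ^ (1 / r) := rfl
    _ ≤ (ENNReal.ofReal (2 ^ r) * (I f + I g)) ^ (1 / r) := by gcongr
    _ = 2 * (I f + I g) ^ (1 / r) := by
      rw [ENNReal.mul_rpow_of_nonneg _ _ (by positivity), ENNReal.ofReal_rpow_of_pos (by positivity),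
        ← Real.rpow_mul two_pos.le, mul_one_div_cancel hr0.ne', Real.rpow_one]
      simp
    _ ≤ 2 * (I f ^ (1 / r) + I g ^ (1 / r)) := by
      gcongr
      exact ENNReal.rpow_add_le_add_rpow _ _ (by positivity) ((div_le_one hr0).2 hr)
    _ = _ := rfl

/-- Needed because `calderonOp` takes `toReal`, which would turn an infinite value into 0 and
destroy lower bounds. -/
lemma calderonFun_lt_top (hr : 1 ≤ r) (hrp : r < p) (hf : f ∈ lorentzAddLinfty p r μ) {t : ℝ≥0∞}
    (ht : t ≠ 0) : calderonFun p r μ f t < ∞ := by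
  have hr0 : 0 < r := by linarith
  have hp0 : 0 < p := by linarith
  obtain ⟨g, h, -, -, hgn, hhn, rfl⟩ := hf
  refine (calderonFun_add_le hr hrp g h t).trans_lt (ENNReal.mul_lt_top (by simp)
    (ENNReal.add_lt_top.2 ⟨(calderonFun_le_lorentzNorm hr0 hp0 g t).trans_lt ?_,
      (calderonFun_le_eLpNorm hr0 hp0 h t).trans_lt hhn⟩))
  exact ENNReal.div_lt_top hgn.ne
    (ENNReal.rpow_pos_of_nonneg (pos_iff_ne_zero.2 ht) (by positivity)).ne'

lemma simpleFunctions_subset_lorentzAddLinfty (hr : 0 < r) (hp : 0 < p) :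
    simpleFunctions X ⊆ lorentzAddLinfty p r μ := by
  intro f hf
  obtain ⟨C, hC⟩ := hf.2.isBounded.exists_norm_le
  refine ⟨0, f, measurable_zero, hf.1, ?_, ?_, (zero_add f).symm⟩
  · rw [lorentzNorm_zero hr hp]; exact ENNReal.zero_lt_top
  · rw [eLpNorm_exponent_top]
    exact (eLpNormEssSup_le_of_ae_bound (C := C) (ae_of_all _ fun x => hC _ ⟨x, rfl⟩)).trans_lt
      ENNReal.ofReal_lt_top

variable {ψ : Y → ℝ≥0∞}

lemma measurable_calderonOp (hr : 0 < r) (hp : 0 < p) (hψ : Measurable ψ) (f : X → ℝ) :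
    Measurable (calderonOp p r μ ψ f) :=
  ((antitone_calderonFun hr hp f).measurable.comp hψ).ennreal_toReal

lemma calderonOp_nonneg {Z : Type*} {ψ : Z → ℝ≥0∞} (f : X → ℝ) (y : Z) : 0 ≤ calderonOp p r μ ψ f y :=
  ENNReal.toReal_nonneg

lemma decRearr_calderonOp_le (hr : 0 < r) (hp : 0 < p)
    (hψν : ∀ t : ℝ, 0 < t → ν {y | ψ y ≤ ENNReal.ofReal t} ≤ ENNReal.ofReal t) (f : X → ℝ) {t : ℝ}
    (ht : 0 < t) :
    decRearr ν (calderonOp p r μ ψ f) t ≤ calderonFun p r μ f (ENNReal.ofReal t) := by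
  refine le_of_forall_gt_imp_ge_of_dense fun b hb => ?_
  by_cases hbt : b = ∞
  · rw [hbt]; exact le_top
  have hb0 : 0 < b.toReal := ENNReal.toReal_pos (lt_of_le_of_lt zero_le hb).ne' hbt
  rw [← ENNReal.ofReal_toReal hbt] at hb ⊢
  refine decRearr_le hb0 ((measure_mono fun y hy => ?_).trans (hψν t ht))
  by_contra hc
  rw [mem_ofPred_eq, not_le] at hc
  have h1 := (antitone_calderonFun (μ := μ) hr hp f hc.le).trans hb.le
  have h2 : calderonOp p r μ ψ f y ≤ b.toReal := ENNReal.toReal_le_of_le_ofReal hb0.le h1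
  have hy' : b.toReal < |calderonOp p r μ ψ f y| := hy
  rw [abs_of_nonneg (calderonOp_nonneg f _)] at hy'
  linarith

lemma lt_calderonOp {Z : Type*} {ψ : Z → ℝ≥0∞} (hr : 1 ≤ r) (hrp : r < p) (hψ0 : ∀ y, ψ y ≠ 0)
    (hf : f ∈ lorentzAddLinfty p r μ) {l : ℝ} (hl : 0 ≤ l) {t : ℝ≥0∞}
    (h : ENNReal.ofReal l < calderonFun p r μ f t) {y : Z} (hy : ψ y ≤ t) :
    l < |calderonOp p r μ ψ f y| := by
  rw [abs_of_nonneg (calderonOp_nonneg f _)]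
  have h1 := h.trans_le (antitone_calderonFun (μ := μ) (by linarith) (by linarith) f hy)
  exact (ENNReal.ofReal_lt_iff_lt_toReal hl (calderonFun_lt_top hr hrp hf (hψ0 y)).ne).1 h1

theorem inClassW_calderonOp (hr : 1 ≤ r) (hrp : r < p) (hψ : Measurable ψ) (hψ0 : ∀ y, ψ y ≠ 0)
    (hψν : ∀ t : ℝ, 0 < t → ENNReal.ofReal (t / 4) ≤ ν {y | ψ y ≤ ENNReal.ofReal t} ∧
      ν {y | ψ y ≤ ENNReal.ofReal t} ≤ ENNReal.ofReal t)
    {𝓓 : Set (X → ℝ)} (h𝓓 : 𝓓 ⊆ lorentzAddLinfty p r μ) :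
    InClassW p r μ ν 𝓓 (calderonOp p r μ ψ) := by
  have hr0 : 0 < r := by linarith
  have hp0 : 0 < p := by linarith
  refine ⟨fun f _ => measurable_calderonOp hr0 hp0 hψ f, ?_, ?_, ?_⟩
  -- Any dilation below 1/4 would do: Tf is at least the Calderón function at t on {ψ ≤ t}, a set of
  -- measure at least t/4 > t/8.
  · refine ⟨2, 1 / 8, by norm_num, by norm_num, by norm_num, fun f₁ hf₁ f₂ hf₂ t ht => ?_⟩
    have key : ∀ f ∈ 𝓓, calderonFun p r μ f (ENNReal.ofReal t) ≤
        decRearr ν (calderonOp p r μ ψ f) (1 / 8 * t) := by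
      intro f hf
      refine le_iInf fun s => le_iInf₂ fun hs hle => ?_
      by_contra! hlt
      have h1 : ENNReal.ofReal (t / 4) ≤ ENNReal.ofReal (1 / 8 * t) :=
        ((hψν t ht).1.trans (measure_mono fun y hy =>
          lt_calderonOp hr hrp hψ0 (h𝓓 hf) hs.le hlt hy)).trans hle
      rw [ENNReal.ofReal_le_ofReal_iff (by positivity)] at h1
      linarith
    rw [show ENNReal.ofReal 2 = 2 by simp]
    exact (decRearr_calderonOp_le hr0 hp0 (fun t ht => (hψν t ht).2) _ ht).trans
      ((calderonFun_add_le hr hrp f₁ f₂ _).trans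
        (mul_le_mul' le_rfl (add_le_add (key f₁ hf₁) (key f₂ hf₂))))
  · refine ⟨1, one_pos, fun f hf l hl => ?_⟩
    rw [ENNReal.ofReal_one, one_mul]
    by_cases htop : lorentzNorm p r μ f = ∞
    · rw [htop]; exact le_top
    set N := (lorentzNorm p r μ f).toReal with hN
    have hNe : lorentzNorm p r μ f = ENNReal.ofReal N := (ENNReal.ofReal_toReal htop).symm
    have hN0 : 0 ≤ N := ENNReal.toReal_nonneg
    have hsub : ∀ t : ℝ, 0 < t → (N / l) ^ p ≤ t →
        distribFun ν (calderonOp p r μ ψ f) l ≤ ENNReal.ofReal t := by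
      intro t ht htN
      refine (measure_mono fun y hy => ?_).trans (hψν t ht).2
      by_contra hc
      rw [mem_ofPred_eq, not_le] at hc
      have h1 := (antitone_calderonFun (μ := μ) hr0 hp0 f hc.le).trans
        (calderonFun_le_lorentzNorm hr0 hp0 f _)
      have htp : 0 < t ^ (1 / p) := by positivity
      rw [hNe, ENNReal.ofReal_rpow_of_pos ht, ← ENNReal.ofReal_div_of_pos htp] at h1
      have h2 : calderonOp p r μ ψ f y ≤ N / t ^ (1 / p) :=
        ENNReal.toReal_le_of_le_ofReal (by positivity) h1
      have h3 : N / l ≤ t ^ (1 / p) := by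
        rw [one_div]
        exact (Real.le_rpow_inv_iff_of_pos (by positivity) ht.le hp0).2 htN
      have hy' : l < |calderonOp p r μ ψ f y| := hy
      rw [abs_of_nonneg (calderonOp_nonneg f _)] at hy'
      have h4 : N / t ^ (1 / p) ≤ l := by
        rw [div_le_iff₀ htp, mul_comm]; rwa [div_le_iff₀ hl] at h3
      linarith
    have hle : distribFun ν (calderonOp p r μ ψ f) l ≤ ENNReal.ofReal ((N / l) ^ p) := by
      refine le_of_forall_gt_imp_ge_of_dense fun b hb => ?_
      by_cases hbt : b = ∞
      · rw [hbt]; exact le_top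
      have hb0 : 0 < b.toReal := ENNReal.toReal_pos (lt_of_le_of_lt zero_le hb).ne' hbt
      rw [← ENNReal.ofReal_toReal hbt] at hb ⊢
      exact hsub _ hb0 ((ENNReal.ofReal_lt_ofReal_iff hb0).1 hb).le
    calc _ ≤ ENNReal.ofReal l * ENNReal.ofReal ((N / l) ^ p) ^ (1 / p) := by gcongr
      _ = _ := by
        rw [ENNReal.ofReal_rpow_of_nonneg (by positivity) (by positivity),
          ← Real.rpow_mul (by positivity), mul_one_div_cancel hp0.ne', Real.rpow_one,
          ← ENNReal.ofReal_mul hl.le, mul_div_cancel₀ _ hl.ne', hNe]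
  · refine ⟨1, one_pos, fun f hf => ?_⟩
    rw [ENNReal.ofReal_one, one_mul, eLpNorm_exponent_top]
    refine eLpNormEssSup_le_of_ae_enorm_bound (ae_of_all _ fun y => ?_)
    rw [Real.enorm_eq_ofReal (calderonOp_nonneg f _)]
    exact ENNReal.ofReal_toReal_le.trans (calderonFun_le_eLpNorm hr0 hp0 f _)

/-- If the support of f has measure at most t, the cap at 1 is inactive and the Calderón function
equals ‖f‖_{p,r} t^{-1/p}. Otherwise the cap is attained at all heights below x₀, so the value is at
least any x₁ < x₀. -/
lemma lt_calderonFun (hr : 1 ≤ r) (hrp : r < p) {x₀ l t : ℝ} (hl : 0 < l) (hlx : l < x₀)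
    (hf : ∀ x, f x = 0 ∨ x₀ ≤ |f x|) (ht : 0 < t)
    (h : ENNReal.ofReal t < (lorentzNorm p r μ f / ENNReal.ofReal l) ^ p) :
    ENNReal.ofReal l < calderonFun p r μ f (ENNReal.ofReal t) := by
  have hr0 : 0 < r := by linarith
  have hp0 : 0 < p := by linarith
  have hte : ENNReal.ofReal t ≠ 0 := (ENNReal.ofReal_pos.2 ht).ne'
  rcases le_or_gt (distribFun μ f 0) (ENNReal.ofReal t) with hm | hm
  · have e : calderonFun p r μ f (ENNReal.ofReal t) =
        lorentzNorm p r μ f / ENNReal.ofReal t ^ (1 / p) := by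
      rw [← lintegral_div_rpow hr0 hp0, calderonFun]
      congr 2
      refine setLIntegral_congr_fun measurableSet_Ioi fun s hs => ?_
      have : distribFun μ f s / ENNReal.ofReal t ≤ 1 :=
        ENNReal.div_le_of_le_mul (by
          rw [one_mul]; exact (antitone_distribFun μ f (le_of_lt hs)).trans hm)
      simp only [min_eq_left this]
    have h2 := ENNReal.rpow_lt_rpow h (show 0 < 1 / p by positivity)
    rw [← ENNReal.rpow_mul, mul_one_div_cancel hp0.ne', ENNReal.rpow_one,
      ENNReal.lt_div_iff_mul_lt (Or.inl (ENNReal.ofReal_pos.2 hl).ne')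
        (Or.inl ENNReal.ofReal_ne_top), mul_comm] at h2
    rw [e, ENNReal.lt_div_iff_mul_lt]
    · exact h2
    · exact Or.inl (ENNReal.rpow_pos_of_nonneg (pos_iff_ne_zero.2 hte) (by positivity)).ne'
    · exact Or.inl (ENNReal.rpow_ne_top_of_nonneg (by positivity) ENNReal.ofReal_ne_top)
  · set x₁ := (l + x₀) / 2 with hx₁
    have hlx₁ : l < x₁ := by rw [hx₁]; linarith
    have hx₁x : x₁ < x₀ := by rw [hx₁]; linarith
    have hx₁0 : 0 < x₁ := hl.trans hlx₁
    refine ((ENNReal.ofReal_lt_ofReal_iff hx₁0).2 hlx₁).trans_le ?_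
    have : ENNReal.ofReal x₁ = (ENNReal.ofReal r *
        ∫⁻ s in Ioc 0 x₁, ENNReal.ofReal (s ^ (r - 1))) ^ (1 / r) := by
      rw [lintegral_rpow_sub_one hr0 le_rfl hx₁0.le, Real.zero_rpow hr0.ne', sub_zero,
        ENNReal.ofReal_rpow_of_pos (by positivity), ← Real.rpow_mul hx₁0.le,
        mul_one_div_cancel hr0.ne', Real.rpow_one]
    rw [this, calderonFun]
    gcongr ?_ ^ _
    refine mul_le_mul' le_rfl (le_trans ?_ (lintegral_mono_set
      (show Ioc 0 x₁ ⊆ Ioi (0 : ℝ) from fun s hs => hs.1)))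
    refine setLIntegral_mono' measurableSet_Ioc fun s hs => ?_
    have hds : ENNReal.ofReal t ≤ distribFun μ f s := by
      refine hm.le.trans (measure_mono fun x hx => ?_)
      have hx' : 0 < |f x| := hx
      rcases hf x with h0 | h0
      · rw [h0, abs_zero] at hx'; exact absurd hx' (lt_irrefl _)
      · exact lt_of_lt_of_le (lt_of_le_of_lt hs.2 hx₁x) h0
    have h1 : 1 ≤ distribFun μ f s / ENNReal.ofReal t := by
      rw [ENNReal.le_div_iff_mul_le (Or.inl hte) (Or.inl ENNReal.ofReal_ne_top), one_mul]
      exact hds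
    rw [min_eq_right h1, ENNReal.one_rpow, one_mul]

lemma le_distribFun_calderonOp (hr : 1 ≤ r) (hrp : r < p) (hψ0 : ∀ y, ψ y ≠ 0)
    (hψν : ∀ t : ℝ, 0 < t → ENNReal.ofReal (t / 4) ≤ ν {y | ψ y ≤ ENNReal.ofReal t})
    (hfm : f ∈ lorentzAddLinfty p r μ) {x₀ l : ℝ} (hl : 0 < l) (hlx : l < x₀)
    (hf : ∀ x, f x = 0 ∨ x₀ ≤ |f x|) :
    (lorentzNorm p r μ f / ENNReal.ofReal l) ^ p ≤
      4 * distribFun ν (calderonOp p r μ ψ f) l := by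
  refine le_of_forall_lt_imp_le_of_dense fun a ha => ?_
  have hat : a ≠ ∞ := ha.ne_top
  rcases (ENNReal.toReal_nonneg (a := a)).eq_or_lt with h0 | hpos
  · rcases (ENNReal.toReal_eq_zero_iff a).1 h0.symm with h | h
    · rw [h]; exact zero_le
    · exact absurd h hat
  rw [← ENNReal.ofReal_toReal hat] at ha ⊢
  have h1 := lt_calderonFun hr hrp hl hlx hf hpos ha
  have h2 := (hψν _ hpos).trans (measure_mono fun y hy =>
    lt_calderonOp hr hrp hψ0 hfm hl.le h1 hy)
  calc ENNReal.ofReal a.toReal = 4 * ENNReal.ofReal (a.toReal / 4) := by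
        rw [show (4 : ℝ≥0∞) = ENNReal.ofReal 4 by simp, ← ENNReal.ofReal_mul (by norm_num)]
        congr 1; ring
    _ ≤ _ := mul_le_mul' le_rfl h2

theorem lintegral_mul_lorentzNorm_rpow_le (hr : 1 ≤ r) (hrp : r < p) (hψ : Measurable ψ)
    (hψ0 : ∀ y, ψ y ≠ 0)
    (hψν : ∀ t : ℝ, 0 < t → ENNReal.ofReal (t / 4) ≤ ν {y | ψ y ≤ ENNReal.ofReal t})
    {φ₁ φ₂ : ℝ → ℝ} (hφ₁ : IsYoungDensity φ₁) {C : ℝ} (hC : 0 < C)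
    (hbdd : ∀ f ∈ simpleFunctions X, f ∈ OrliczSpace (youngFun φ₂) μ →
      gaugeNorm (youngFun φ₁) ν (calderonOp p r μ ψ f) ≤
        ENNReal.ofReal C * gaugeNorm (youngFun φ₂) μ f)
    (hfs : f ∈ simpleFunctions X) {x₀ : ℝ} (hf : ∀ x, f x = 0 ∨ x₀ ≤ |f x|)
    (hint : ∫⁻ x, ENNReal.ofReal (youngFun φ₂ |f x|) ∂μ ≤ 1) :
    (∫⁻ y in Ioo 0 (x₀ / (2 * C)), ENNReal.ofReal (φ₁ y / y ^ p)) *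
      (lorentzNorm p r μ f / ENNReal.ofReal (2 * C)) ^ p ≤ 4 := by
  have hr0 : 0 < r := by linarith
  have hp0 : 0 < p := by linarith
  -- Doubling C makes the gauge norm of Tf strictly less than l, so some admissible scale in the
  -- infimum lies below l and the modular at l is at most 1.
  set l := 2 * C with hl
  have hl0 : 0 < l := by positivity
  set Tf := calderonOp p r μ ψ f with hTf
  have hTm : Measurable Tf := measurable_calderonOp hr0 hp0 hψ f
  have hg1 : gaugeNorm (youngFun φ₂) μ f ≤ 1 := by
    refine iInf_le_of_le 1 (iInf₂_le_of_le one_pos ?_ (by simp))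
    simpa using hint
  have hg2 : gaugeNorm (youngFun φ₁) ν Tf < ENNReal.ofReal l := by
    refine ((hbdd f hfs ⟨hfs.1, 1, one_pos, by simpa using hint.trans_lt ENNReal.one_lt_top⟩).trans
      (mul_le_mul' le_rfl hg1)).trans_lt ?_
    rw [mul_one]
    exact (ENNReal.ofReal_lt_ofReal_iff hl0).2 (by rw [hl]; linarith)
  have hint1 : ∫⁻ y, ENNReal.ofReal (youngFun φ₁ |Tf y / l|) ∂ν ≤ 1 := by
    simp only [gaugeNorm, iInf_lt_iff] at hg2
    obtain ⟨l', hl', hle, hlt⟩ := hg2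
    refine le_trans (lintegral_mono fun y => ENNReal.ofReal_le_ofReal ?_) hle
    rw [abs_div, abs_of_pos hl0]
    refine hφ₁.youngFun_mono (mem_Ici.2 (by positivity)) (mem_Ici.2 (by positivity)) ?_
    exact div_le_div_of_nonneg_left (abs_nonneg _) hl' (((ENNReal.ofReal_lt_ofReal_iff hl0).1 hlt).le)
  rw [hφ₁.lintegral_youngFun ν (hTm.div_const l)] at hint1
  have hφm : AEMeasurable φ₁ (volume.restrict (Ioo 0 (x₀ / l))) :=
    hφ₁.aemeasurable_restrict_pos measurableSet_Ioo Ioo_subset_Ioi_self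
  rw [← lintegral_mul_const'' _ (by fun_prop)]
  calc ∫⁻ y in Ioo 0 (x₀ / l), ENNReal.ofReal (φ₁ y / y ^ p) *
        (lorentzNorm p r μ f / ENNReal.ofReal l) ^ p
      ≤ ∫⁻ y in Ioo 0 (x₀ / l), 4 * (distribFun ν (fun y => Tf y / l) y * ENNReal.ofReal (φ₁ y)) := by
        refine setLIntegral_mono' measurableSet_Ioo fun s hs => ?_
        have hs0 : 0 < s := hs.1
        have hsp : 0 < s ^ p := by positivity
        have hls : l * s < x₀ := by
          have := hs.2; rw [lt_div_iff₀ hl0] at this; linarith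
        have hd : distribFun ν (fun y => Tf y / l) s = distribFun ν Tf (l * s) := by
          simp only [distribFun, abs_div, abs_of_pos hl0, lt_div_iff₀ hl0]
          rw [mul_comm]
        have := le_distribFun_calderonOp (μ := μ) (ν := ν) hr hrp hψ0 hψν
          (simpleFunctions_subset_lorentzAddLinfty hr0 hp0 hfs) (mul_pos hl0 hs0) hls hf
        rw [hd, ← mul_assoc]
        refine le_trans (le_of_eq ?_) (mul_le_mul' this le_rfl)
        rw [ENNReal.ofReal_mul hl0.le, ENNReal.ofReal_div_of_pos hsp, ← ENNReal.ofReal_rpow_of_pos hs0]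
        simp only [div_eq_mul_inv]
        rw [ENNReal.mul_inv (Or.inl (ENNReal.ofReal_pos.2 hl0).ne') (Or.inl ENNReal.ofReal_ne_top),
          ← mul_assoc, ENNReal.mul_rpow_of_nonneg _ (ENNReal.ofReal s)⁻¹ hp0.le,
          ENNReal.inv_rpow (ENNReal.ofReal s)]
        ring
    _ = 4 * ∫⁻ y in Ioo 0 (x₀ / l), distribFun ν (fun y => Tf y / l) y * ENNReal.ofReal (φ₁ y) :=
        lintegral_const_mul' _ _ (by simp)
    _ ≤ 4 * 1 := mul_le_mul' le_rfl ((lintegral_mono_set Ioo_subset_Ioi_self).trans hint1)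
    _ = 4 := mul_one _

end Calderon

/-! ### Dyadic control of the tail integral -/

namespace IsYoungDensity

variable {φ : ℝ → ℝ}

/-- Formally the substitution τ = Φ(y). The measure φ dy on (z, ∞) gives Iic y mass at most Φ(y), so
the layer-cake bound for exponents above 1 applies with G = Φ, bounded below by Φ(z). -/
lemma lintegral_div_rpow_le (hφ : IsYoungDensity φ) {b z : ℝ} (hb : 1 < b) (hz : 0 < z)
    (h : 0 < youngFun φ z) :
    ∫⁻ y in Ioi z, ENNReal.ofReal (φ y / youngFun φ y ^ b) ≤
      ENNReal.ofReal (b / (b - 1) * youngFun φ z ^ (1 - b)) := by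
  set w : ℝ → ℝ≥0∞ := (Ioi z).indicator
    fun y => ENNReal.ofReal ((Ioi (0 : ℝ)).indicator φ y) with hw
  have hφm := hφ.measurable_indicator
  have hwm : Measurable w := Measurable.indicator (by fun_prop) measurableSet_Ioi
  set G : ℝ → ℝ≥0∞ := fun y => ENNReal.ofReal (youngFun φ |y|) with hG
  have hGm : Measurable G := hφ.measurable_youngFun_abs.ennreal_ofReal
  have hIic : ∀ x, volume.withDensity w (Iic x) ≤ G x := by
    intro x
    rw [withDensity_apply _ measurableSet_Iic, hw, setLIntegral_indicator measurableSet_Ioi,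
      Ioi_inter_Iic]
    rcases le_total x z with hxz | hxz
    · rw [Ioc_eq_empty (not_lt.2 hxz)]; simp
    · have hx0 : 0 < x := hz.trans_le hxz
      have : ∫⁻ y in Ioc z x, ENNReal.ofReal ((Ioi (0 : ℝ)).indicator φ y) =
          ∫⁻ y in Ioc z x, ENNReal.ofReal (φ y) :=
        setLIntegral_congr_fun measurableSet_Ioc fun y hy => by
          simp only [indicator_of_mem (show y ∈ Ioi (0 : ℝ) from hz.trans hy.1)]
      rw [this, ← hφ.ofReal_youngFun_sub hz.le hxz, hG]
      simp only [abs_of_pos hx0]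
      exact ENNReal.ofReal_le_ofReal (by linarith)
  have hle : ∀ᵐ y ∂volume.withDensity w, ENNReal.ofReal (youngFun φ z) ≤ G y := by
    rw [hw, withDensity_indicator measurableSet_Ioi]
    refine (withDensity_absolutelyContinuous _ _).ae_le ?_
    filter_upwards [ae_restrict_mem measurableSet_Ioi] with y hy
    have hy0 : 0 < y := hz.trans hy
    simp only [hG, abs_of_pos hy0]
    exact ENNReal.ofReal_le_ofReal
      (hφ.youngFun_mono (mem_Ici.2 hz.le) (mem_Ici.2 hy0.le) (le_of_lt hy))
  have key := lintegral_inv_rpow_le_of_one_lt (m := volume.withDensity w) hGm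
    (fun τ => (measure_mono fun y hy => (hIic y).trans_lt hy).trans (measure_Iic_lt_le _ τ)) hb h hle
  refine le_trans (le_of_eq ?_) key
  rw [lintegral_withDensity_eq_lintegral_mul _ hwm (by fun_prop),
    ← lintegral_indicator measurableSet_Ioi]
  refine lintegral_congr fun y => ?_
  by_cases hy : y ∈ Ioi z
  · have hy0 : 0 < y := hz.trans hy
    have hΦ : 0 < youngFun φ y :=
      h.trans_le (hφ.youngFun_mono (mem_Ici.2 hz.le) (mem_Ici.2 hy0.le) (le_of_lt hy))
    simp only [hw, hG, Pi.mul_apply, indicator_of_mem hy,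
      indicator_of_mem (show y ∈ Ioi (0 : ℝ) from hy0), abs_of_pos hy0]
    rw [ENNReal.inv_rpow, ENNReal.ofReal_rpow_of_pos hΦ, ENNReal.ofReal_div_of_pos (by positivity),
      div_eq_mul_inv]
  · simp only [hw, Pi.mul_apply, indicator_of_notMem hy, zero_mul]

/-- On the block [2^j z, 2^(j+1) z) the power y^c is frozen at the right endpoint; the rest is
bounded by its integral over the whole tail beyond 2^j z. -/
lemma lintegral_weight_le_tsum (hφ : IsYoungDensity φ) {b c z : ℝ} (hb : 1 < b) (hc : 0 ≤ c)
    (hz : 0 < z) (h : 0 < youngFun φ z) :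
    ∫⁻ y in Ioi z, ENNReal.ofReal (φ y / youngFun φ y ^ b * y ^ c) ≤
      ENNReal.ofReal (2 ^ c * (b / (b - 1))) *
        ∑' j : ℕ, ENNReal.ofReal ((2 ^ j * z) ^ c * youngFun φ (2 ^ j * z) ^ (1 - b)) := by
  have hcover : Ioi z ⊆ ⋃ j : ℕ, Ico (2 ^ j * z) (2 ^ (j + 1) * z) := by
    intro y hy
    obtain ⟨j, h1, h2⟩ := exists_nat_pow_near (x := y / z) (y := (2 : ℝ))
      ((one_le_div hz).2 (le_of_lt hy)) one_lt_two
    exact mem_iUnion.2 ⟨j, (le_div_iff₀ hz).1 h1, (div_lt_iff₀ hz).1 h2⟩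
  refine (lintegral_mono_set hcover).trans ((lintegral_iUnion_le _ _).trans ?_)
  rw [← ENNReal.tsum_mul_left]
  refine ENNReal.tsum_le_tsum fun j => ?_
  set zj : ℝ := 2 ^ j * z with hzj
  have hzj0 : 0 < zj := by positivity
  have hzzj : z ≤ zj := le_mul_of_one_le_left hz.le (one_le_pow₀ one_le_two)
  have hΦj : 0 < youngFun φ zj :=
    h.trans_le (hφ.youngFun_mono (mem_Ici.2 hz.le) (mem_Ici.2 hzj0.le) hzzj)
  have hb1 : 0 < b - 1 := by linarith
  calc ∫⁻ y in Ico zj (2 ^ (j + 1) * z), ENNReal.ofReal (φ y / youngFun φ y ^ b * y ^ c)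
      ≤ ∫⁻ y in Ico zj (2 ^ (j + 1) * z),
          ENNReal.ofReal ((2 * zj) ^ c) * ENNReal.ofReal (φ y / youngFun φ y ^ b) := by
        refine setLIntegral_mono' measurableSet_Ico fun y hy => ?_
        have hy0 : 0 < y := hzj0.trans_le hy.1
        have := hφ.nonneg y hy0
        have := hφ.youngFun_nonneg hy0.le
        rw [← ENNReal.ofReal_mul (by positivity), mul_comm]
        refine ENNReal.ofReal_le_ofReal ?_
        gcongr
        rw [hzj, ← mul_assoc, ← pow_succ']
        exact hy.2.le
    _ ≤ ENNReal.ofReal ((2 * zj) ^ c) * ∫⁻ y in Ici zj, ENNReal.ofReal (φ y / youngFun φ y ^ b) := by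
        rw [lintegral_const_mul' _ _ ENNReal.ofReal_ne_top]
        exact mul_le_mul' le_rfl (lintegral_mono_set Ico_subset_Ici_self)
    _ ≤ ENNReal.ofReal ((2 * zj) ^ c) * ENNReal.ofReal (b / (b - 1) * youngFun φ zj ^ (1 - b)) := by
        rw [setLIntegral_congr Ioi_ae_eq_Ici.symm]
        exact mul_le_mul' le_rfl (hφ.lintegral_div_rpow_le hb hzj0 hΦj)
    _ = _ := by
        rw [← ENNReal.ofReal_mul (by positivity), ← ENNReal.ofReal_mul (by positivity),
          Real.mul_rpow two_pos.le hzj0.le]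
        congr 1; ring

end IsYoungDensity

/-! ### Dyadic test functions -/

section DyadicStep

variable {X : Type*}

/-- The step function with value `2 ^ j * z` on `A j`. -/
noncomputable def dyadicStep (A : ℕ → Set X) (z : ℝ) (n : ℕ) (x : X) : ℝ :=
  ∑ j ∈ Finset.range n, (A j).indicator (fun _ => 2 ^ j * z) x

lemma dyadicStep_eq {A : ℕ → Set X} (hd : Pairwise (Function.onFun Disjoint A)) {z : ℝ} {n j : ℕ}
    (hj : j < n) {x : X} (hx : x ∈ A j) : dyadicStep A z n x = 2 ^ j * z := by
  unfold dyadicStep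
  rw [Finset.sum_eq_single j, indicator_of_mem hx]
  · intro i _ hij
    exact indicator_of_notMem (fun hi => disjoint_left.1 (hd hij) hi hx) _
  · intro h
    exact absurd (Finset.mem_range.2 hj) h

lemma dyadicStep_eq_zero {A : ℕ → Set X} {z : ℝ} {n : ℕ} {x : X} (hx : ∀ j < n, x ∉ A j) :
    dyadicStep A z n x = 0 :=
  Finset.sum_eq_zero fun j hj => indicator_of_notMem (hx j (Finset.mem_range.1 hj)) _

end DyadicStep

/-! ### Boundedness implies the Cianchi condition -/

section Necessity

variable {X Y : Type*} [MeasurableSpace X] [MeasurableSpace Y] {p r : ℝ} {μ : Measure X}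
  {ν : Measure Y} {φ₁ φ₂ : ℝ → ℝ}

/-- The intervals (2^j z / 2, 2^j z) are disjoint, and on each r s^{r-1} integrates to at least (2^j
z / 2)^r because 2^r ≥ 2. -/
lemma sum_le_lorentzNorm_rpow (hr : 1 ≤ r) (hp : 0 < p) {f : X → ℝ} {z : ℝ} (hz : 0 < z) (n : ℕ)
    (m : ℕ → ℝ≥0∞) (hm : ∀ j < n, ∀ s < 2 ^ j * z, m j ≤ distribFun μ f s) :
    ∑ j ∈ Finset.range n, m j ^ (r / p) * ENNReal.ofReal ((2 ^ j * z / 2) ^ r) ≤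
      lorentzNorm p r μ f ^ r := by
  have hr0 : 0 < r := by linarith
  set F : ℝ → ℝ≥0∞ := fun s => distribFun μ f s ^ (r / p) * ENNReal.ofReal (s ^ (r - 1)) with hF
  have hmono : Monotone fun j : ℕ => (2 : ℝ) ^ j * z / 2 := fun i j hij => by
    have := pow_le_pow_right₀ (one_le_two (α := ℝ)) hij
    simp only; gcongr
  have hdis := hmono.pairwise_disjoint_on_Ioo_succ
  rw [lorentzNorm, ← ENNReal.rpow_mul, one_div_mul_cancel hr0.ne', ENNReal.rpow_one]
  calc _ ≤ ∑ j ∈ Finset.range n, ENNReal.ofReal r *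
        ∫⁻ s in Ioo (2 ^ j * z / 2) (2 ^ (Order.succ j) * z / 2), F s := by
        refine Finset.sum_le_sum fun j hj => ?_
        have hzj : (0 : ℝ) < 2 ^ j * z := by positivity
        have e : (2 : ℝ) ^ (Order.succ j) * z / 2 = 2 ^ j * z := by
          rw [Order.succ_eq_add_one, pow_succ]; ring
        rw [e]
        calc _ ≤ m j ^ (r / p) * ENNReal.ofReal ((2 ^ j * z) ^ r - (2 ^ j * z / 2) ^ r) := by
              refine mul_le_mul' le_rfl (ENNReal.ofReal_le_ofReal ?_)
              have h2 : (2 ^ j * z) ^ r = 2 ^ r * (2 ^ j * z / 2) ^ r := by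
                rw [← Real.mul_rpow two_pos.le (by positivity)]; congr 1; ring
              have h3 : (2 : ℝ) ≤ 2 ^ r := by
                simpa using Real.rpow_le_rpow_of_exponent_le one_le_two hr
              have h4 : 0 ≤ (2 ^ j * z / 2) ^ r := by positivity
              rw [h2]; nlinarith
          _ = ENNReal.ofReal r * ∫⁻ s in Ioo (2 ^ j * z / 2) (2 ^ j * z),
                ENNReal.ofReal (s ^ (r - 1)) * m j ^ (r / p) := by
              rw [← lintegral_rpow_sub_one hr0 (by positivity) (by linarith),
                lintegral_mul_const _ (by fun_prop), setLIntegral_congr Ioo_ae_eq_Ioc]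
              ring
          _ ≤ _ := by
              refine mul_le_mul' le_rfl (setLIntegral_mono' measurableSet_Ioo fun s hs => ?_)
              rw [hF, mul_comm]
              exact mul_le_mul' (ENNReal.rpow_le_rpow (hm j (Finset.mem_range.1 hj) s hs.2)
                (by positivity)) le_rfl
    _ = ENNReal.ofReal r * ∫⁻ s in ⋃ j ∈ Finset.range n,
          Ioo (2 ^ j * z / 2) (2 ^ (Order.succ j) * z / 2), F s := by
        rw [← Finset.mul_sum, lintegral_biUnion_finset (fun i _ j _ hij => hdis hij)
          fun _ _ => measurableSet_Ioo]
    _ ≤ _ := by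
        refine mul_le_mul' le_rfl (lintegral_mono_set (iUnion₂_subset fun j _ s hs => ?_))
        exact lt_trans (by positivity) hs.1

lemma dyadicStep_mem_simpleFunctions {A : ℕ → Set X} (hA : ∀ j, MeasurableSet (A j))
    (hd : Pairwise (Function.onFun Disjoint A)) (z : ℝ) (n : ℕ) :
    dyadicStep A z n ∈ simpleFunctions X := by
  refine ⟨Finset.measurable_sum _ fun j _ => measurable_const.indicator (hA j), ?_⟩
  refine ((Finset.range n).finite_toSet.image (fun j : ℕ => (2 : ℝ) ^ j * z) |>.insert 0).subset ?_
  rintro _ ⟨x, rfl⟩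
  by_cases h : ∃ j < n, x ∈ A j
  · obtain ⟨j, hj, hx⟩ := h
    exact Or.inr ⟨j, by simpa using hj, (dyadicStep_eq hd hj hx).symm⟩
  · push Not at h
    exact Or.inl (dyadicStep_eq_zero h)

lemma lintegral_youngFun_dyadicStep_le {φ : ℝ → ℝ} {A : ℕ → Set X} (hA : ∀ j, MeasurableSet (A j))
    (hd : Pairwise (Function.onFun Disjoint A)) {z : ℝ} (hz : 0 < z) (n : ℕ) :
    ∫⁻ x, ENNReal.ofReal (youngFun φ |dyadicStep A z n x|) ∂μ ≤
      ∑ j ∈ Finset.range n, ENNReal.ofReal (youngFun φ (2 ^ j * z)) * μ (A j) := by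
  calc _ ≤ ∫⁻ x, ∑ j ∈ Finset.range n,
        (A j).indicator (fun _ => ENNReal.ofReal (youngFun φ (2 ^ j * z))) x ∂μ := by
        refine lintegral_mono fun x => ?_
        by_cases h : ∃ j < n, x ∈ A j
        · obtain ⟨j, hj, hx⟩ := h
          rw [dyadicStep_eq hd hj hx, abs_of_pos (by positivity)]
          refine le_trans (le_of_eq ?_) (Finset.single_le_sum (fun _ _ => zero_le)
            (Finset.mem_range.2 hj))
          rw [indicator_of_mem hx]
        · push Not at h
          rw [dyadicStep_eq_zero h]
          simp
    _ = _ := by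
        rw [lintegral_finsetSum _ fun j _ => measurable_const.indicator (hA j)]
        simp only [lintegral_indicator_const (hA _)]

/-- With m_j the measure of the j-th set, this says m_j^{1/q} (2^j z)^r = a_j J^{-1/q}; summing over
j gives J^{1-1/q} = J^{1/q'}, the equality case of Hölder. -/
lemma dyadic_weight_identity {q q' r z F J : ℝ} (hq : q.HolderConjugate q') (hz : 0 < z)
    (hF : 0 < F) (hJ : 0 < J) :
    (z ^ (r * q') * F ^ (-q') / J) ^ (1 / q) * z ^ r = z ^ (r * q') * F ^ (1 - q') * J ^ (-(1 / q)) := by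
  have hsum : 1 / q + 1 / q' = 1 := by simpa using hq.inv_add_inv_eq_one
  have hq0 := hq.pos
  have hq'0 := hq.symm.pos
  have e1 : q' * (1 / q) = q' - 1 := by
    have : 1 / q = 1 - 1 / q' := by linarith
    rw [this]; field_simp
  rw [Real.div_rpow (by positivity) hJ.le, Real.mul_rpow (by positivity) (by positivity),
    ← Real.rpow_mul hz.le, ← Real.rpow_mul hF.le, Real.rpow_neg hJ.le, mul_assoc r, e1, neg_mul, e1,
    neg_sub, show r * q' = r * (q' - 1) + r by ring, Real.rpow_add hz]
  field_simp

theorem cianchiCondition_of_lorentz_bound [SigmaFinite μ] (hμ : IsNonatomic μ) (hinf : μ univ = ∞)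
    (hr : 1 ≤ r) (hrp : r < p) (hφ₂ : IsYoungDensity φ₂) {l : ℝ} (hl : 0 < l)
    (h : ∀ f ∈ simpleFunctions X, ∀ x₀ : ℝ, 0 < x₀ → (∀ x, f x = 0 ∨ x₀ ≤ |f x|) →
      ∫⁻ x, ENNReal.ofReal (youngFun φ₂ |f x|) ∂μ ≤ 1 →
      (∫⁻ y in Ioo 0 (x₀ / l), ENNReal.ofReal (φ₁ y / y ^ p)) *
        (lorentzNorm p r μ f / ENNReal.ofReal l) ^ p ≤ 4) :
    CianchiCondition p r φ₁ φ₂ := by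
  have hr0 : 0 < r := by linarith
  have hp0 : 0 < p := by linarith
  unfold CianchiCondition
  set q := p / r with hqdef
  set q' := Real.conjExponent q with hq'def
  have hq1 : 1 < q := (one_lt_div hr0).2 hrp
  have hq : q.HolderConjugate q' := Real.HolderConjugate.conjExponent hq1
  have hq0 : 0 < q := hq.pos
  have hq'0 : 0 < q' := hq.symm.pos
  have hq'1 : 1 < q' := hq.symm.lt
  have hq'1' : 0 < q' - 1 := by linarith
  have hrpq : r / p = 1 / q := by rw [hqdef]; field_simp
  have hsum : 1 / q + 1 / q' = 1 := by simpa using hq.inv_add_inv_eq_one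
  set B₀ : ℝ := (4 * (2 * l) ^ p) ^ (1 / q) with hB₀
  have hB₀0 : 0 < B₀ := by positivity
  set K : ℝ := (l ^ (r * q') * l)⁻¹ * (2 ^ (r * q') * (q' / (q' - 1))) with hK
  have hK0 : 0 < K := by positivity
  -- The constant D is l: a test function with smallest nonzero value z = l x sees φ₁ up to z / l =
  -- x, while Φ₂ is evaluated from z on.
  refine ⟨K ^ (1 / q') * B₀, l, by positivity, hl, fun x hx => ?_⟩
  set W := ∫⁻ y in Ioo 0 x, ENNReal.ofReal (φ₁ y / y ^ p) with hW
  set z := l * x with hz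
  have hz0 : 0 < z := by positivity
  have hzl : z / l = x := by rw [hz]; field_simp
  rcases (hφ₂.youngFun_nonneg hz0.le).eq_or_lt with h0 | hpos
  -- If Φ₂(z) = 0, the constant z has zero modular but infinite Lorentz functional, since μ(X) = ∞.
  -- The bound then forces W = 0, and 0 · ∞ = 0 covers the infinite tail integral.
  · have hW0 : W = 0 := by
      have hc := h (fun _ => z) ⟨measurable_const, finite_range_const⟩ z hz0
        (fun _ => Or.inr (le_abs_self z)) (by simp [abs_of_pos hz0, ← h0])
      have htop : lorentzNorm p r μ (fun _ : X => z) = ∞ := by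
        have := sum_le_lorentzNorm_rpow (μ := μ) (f := fun _ => z) (m := fun _ => ∞) hr hp0 hz0 1
          (by
            intro j hj s hs
            have hj0 : j = 0 := by omega
            rw [hj0, pow_zero, one_mul] at hs
            simp [distribFun, hs.trans_le (le_abs_self z), hinf])
        rw [Finset.sum_range_one, ENNReal.top_rpow_of_pos (by positivity), ENNReal.top_mul
          (ENNReal.ofReal_pos.2 (by positivity)).ne', top_le_iff] at this
        by_contra hne
        exact ENNReal.rpow_ne_top_of_nonneg hr0.le hne this
      rw [hzl, htop, ENNReal.top_div_of_ne_top ENNReal.ofReal_ne_top,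
        ENNReal.top_rpow_of_pos hp0] at hc
      by_contra hne
      rw [ENNReal.mul_top hne] at hc
      exact absurd hc (by simp)
    rw [hW0, ENNReal.zero_rpow_of_pos (by positivity), mul_zero]
    exact zero_le
  · set a : ℕ → ℝ := fun j => (2 ^ j * z) ^ (r * q') * youngFun φ₂ (2 ^ j * z) ^ (1 - q') with ha
    have hzj : ∀ j : ℕ, 0 < 2 ^ j * z := fun j => by positivity
    have hΦj : ∀ j : ℕ, 0 < youngFun φ₂ (2 ^ j * z) := fun j =>
      hpos.trans_le (hφ₂.youngFun_mono (mem_Ici.2 hz0.le) (mem_Ici.2 (hzj j).le)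
        (le_mul_of_one_le_left hz0.le (one_le_pow₀ one_le_two)))
    have ha0 : ∀ j, 0 < a j := fun j =>
      mul_pos (Real.rpow_pos_of_pos (hzj j) _) (Real.rpow_pos_of_pos (hΦj j) _)
    have hpartial : ∀ n, (∑ j ∈ Finset.range n, ENNReal.ofReal (a j)) ^ (1 / q') * W ^ (1 / q) ≤
        ENNReal.ofReal B₀ := by
      intro n
      rcases Nat.eq_zero_or_pos n with rfl | hn
      · rw [Finset.sum_range_zero, ENNReal.zero_rpow_of_pos (by positivity), zero_mul]
        exact zero_le
      set J := ∑ j ∈ Finset.range n, a j with hJ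
      have hJ0 : 0 < J := Finset.sum_pos (fun j _ => ha0 j) ⟨0, Finset.mem_range.2 hn⟩
      -- Measures proportional to the Hölder extremiser, normalised by J so that ∑ Φ₂(2^j z) m_j =
      -- 1. Only n blocks are used, to stay within simple functions; n → ∞ comes afterwards.
      set m : ℕ → ℝ := fun j =>
        (2 ^ j * z) ^ (r * q') * youngFun φ₂ (2 ^ j * z) ^ (-q') / J with hm
      have hm0 : ∀ j, 0 < m j := fun j => div_pos
        (mul_pos (Real.rpow_pos_of_pos (hzj j) _) (Real.rpow_pos_of_pos (hΦj j) _)) hJ0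
      obtain ⟨A, hA, hAm, hd⟩ := hμ.exists_pairwise_disjoint hinf
        (fun j => ENNReal.ofReal (m j)) fun _ => ENNReal.ofReal_ne_top
      have hc := h (dyadicStep A z n) (dyadicStep_mem_simpleFunctions hA hd z n) z hz0 (by
          intro y
          by_cases hy : ∃ j < n, y ∈ A j
          · obtain ⟨j, hj, hyj⟩ := hy
            rw [dyadicStep_eq hd hj hyj, abs_of_pos (hzj j)]
            exact Or.inr (le_mul_of_one_le_left hz0.le (one_le_pow₀ one_le_two))
          · push Not at hy
            exact Or.inl (dyadicStep_eq_zero hy)) (by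
          refine (lintegral_youngFun_dyadicStep_le hA hd hz0 n).trans (le_of_eq ?_)
          have : ∀ j, ENNReal.ofReal (youngFun φ₂ (2 ^ j * z)) * μ (A j) =
              ENNReal.ofReal (a j / J) := by
            intro j
            rw [hAm, ← ENNReal.ofReal_mul (hΦj j).le]
            congr 1
            simp only [hm, ha]
            rw [show 1 - q' = -q' + 1 by ring, Real.rpow_add_one (hΦj j).ne']
            ring
          simp only [this]
          rw [← ENNReal.ofReal_sum_of_nonneg fun j _ => (div_pos (ha0 j) hJ0).le,
            ← Finset.sum_div, ← hJ, div_self hJ0.ne', ENNReal.ofReal_one])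
      have hlow := sum_le_lorentzNorm_rpow (μ := μ) (f := dyadicStep A z n)
        (m := fun j => ENNReal.ofReal (m j)) hr hp0 hz0 n (by
          intro j hj s hs
          rw [← hAm j]
          refine measure_mono fun y hy => ?_
          rw [mem_ofPred_eq, dyadicStep_eq hd hj hy]
          exact hs.trans_le (le_abs_self _))
      have hlow' : ENNReal.ofReal (J ^ (1 / q') * (1 / 2) ^ r) ≤
          lorentzNorm p r μ (dyadicStep A z n) ^ r := by
        refine le_trans (le_of_eq ?_) hlow
        have : ∀ j, ENNReal.ofReal (m j) ^ (r / p) * ENNReal.ofReal ((2 ^ j * z / 2) ^ r) =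
            ENNReal.ofReal (a j * (J ^ (-(1 / q)) * (1 / 2) ^ r)) := by
          intro j
          rw [hrpq, ENNReal.ofReal_rpow_of_pos (hm0 j), ← ENNReal.ofReal_mul
            (Real.rpow_nonneg (hm0 j).le _), div_eq_mul_one_div (2 ^ j * z) 2,
            Real.mul_rpow (hzj j).le (by norm_num), ← mul_assoc (m j ^ (1 / q)),
            ← mul_assoc (a j)]
          exact congrArg (fun t => ENNReal.ofReal (t * (1 / 2) ^ r))
            (dyadic_weight_identity hq (hzj j) (hΦj j) hJ0)
        simp only [this]
        rw [← ENNReal.ofReal_sum_of_nonneg fun j _ => by have := ha0 j; positivity,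
          ← Finset.sum_mul, ← hJ, ← mul_assoc]
        congr 2
        rw [show 1 / q' = 1 + -(1 / q) by linarith, Real.rpow_one_add' hJ0.le]
        rw [show 1 + -(1 / q) = 1 / q' by linarith]
        positivity
      rw [hzl] at hc
      have hc' := ENNReal.rpow_le_rpow hc (show 0 ≤ 1 / q by positivity)
      rw [ENNReal.mul_rpow_of_nonneg _ _ (by positivity), ← ENNReal.rpow_mul,
        show p * (1 / q) = r by rw [hqdef]; field_simp,
        ENNReal.div_rpow_of_nonneg _ _ hr0.le] at hc'
      have hJe : ∑ j ∈ Finset.range n, ENNReal.ofReal (a j) = ENNReal.ofReal J :=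
        (ENNReal.ofReal_sum_of_nonneg fun j _ => (ha0 j).le).symm
      have h2l : 0 < (2 * l) ^ r := by positivity
      calc (∑ j ∈ Finset.range n, ENNReal.ofReal (a j)) ^ (1 / q') * W ^ (1 / q)
          = ENNReal.ofReal ((2 * l) ^ r) * (W ^ (1 / q) *
              (ENNReal.ofReal (J ^ (1 / q') * (1 / 2) ^ r) / ENNReal.ofReal l ^ r)) := by
            rw [hJe, ENNReal.ofReal_rpow_of_pos hJ0, ENNReal.ofReal_rpow_of_pos hl,
              ← ENNReal.ofReal_div_of_pos (by positivity), mul_left_comm, mul_comm,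
              ← ENNReal.ofReal_mul h2l.le]
            congr 2
            rw [Real.mul_rpow two_pos.le hl.le, Real.div_rpow one_pos.le two_pos.le, Real.one_rpow]
            field_simp
        _ ≤ ENNReal.ofReal ((2 * l) ^ r) * 4 ^ (1 / q) :=
            mul_le_mul' le_rfl ((mul_le_mul' le_rfl (ENNReal.div_le_div_right hlow' _)).trans hc')
        _ = ENNReal.ofReal B₀ := by
            rw [show (4 : ℝ≥0∞) = ENNReal.ofReal 4 by simp, ENNReal.ofReal_rpow_of_pos (by norm_num),
              ← ENNReal.ofReal_mul h2l.le, hB₀, Real.mul_rpow (x := 4) (by norm_num) (by positivity),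
              ← Real.rpow_mul (x := 2 * l) (by positivity),
              show p * (1 / q) = r by rw [hqdef]; field_simp, mul_comm]
    have htsum : (∑' j, ENNReal.ofReal (a j)) ^ (1 / q') * W ^ (1 / q) ≤ ENNReal.ofReal B₀ := by
      have hB₀' : ENNReal.ofReal B₀ ≠ 0 := (ENNReal.ofReal_pos.2 hB₀0).ne'
      rw [← ENNReal.le_div_iff_mul_le (Or.inr hB₀') (Or.inr ENNReal.ofReal_ne_top), one_div q',
        ENNReal.rpow_inv_le_iff hq'0]
      refine ENNReal.tsum_le_of_sum_range_le fun n => ?_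
      rw [← ENNReal.rpow_inv_le_iff hq'0, ← one_div q',
        ENNReal.le_div_iff_mul_le (Or.inr hB₀') (Or.inr ENNReal.ofReal_ne_top)]
      exact hpartial n
    -- Substituting l y for y turns the tail from x into the tail from z; the factor (l^{rq'} l)⁻¹
    -- in K is the Jacobian together with the power of y.
    have hV : ∫⁻ y in Ioi x, ENNReal.ofReal
        (φ₂ (l * y) / youngFun φ₂ (l * y) ^ q' * y ^ (r * q')) ≤
        ENNReal.ofReal K * ∑' j, ENNReal.ofReal (a j) := by
      have hscale := lintegral_Ioi_comp_mul_left hl ((Ioi z).indicator fun y =>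
        ENNReal.ofReal (φ₂ y / youngFun φ₂ y ^ q' * y ^ (r * q')))
      rw [setLIntegral_indicator measurableSet_Ioi, Ioi_inter_Ioi, sup_eq_left.2 hz0.le] at hscale
      have hle := hφ₂.lintegral_weight_le_tsum hq'1 (c := r * q') (by positivity) hz0 hpos
      rw [hscale] at hle
      calc _ ≤ ENNReal.ofReal (l ^ (r * q') * l)⁻¹ * (ENNReal.ofReal l *
            ∫⁻ t in Ioi (0 : ℝ), (Ioi z).indicator (fun y =>
              ENNReal.ofReal (φ₂ y / youngFun φ₂ y ^ q' * y ^ (r * q'))) (l * t)) := by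
            rw [← mul_assoc, ← ENNReal.ofReal_mul (by positivity),
              ← lintegral_const_mul' _ _ ENNReal.ofReal_ne_top,
              ← lintegral_indicator measurableSet_Ioi, ← lintegral_indicator measurableSet_Ioi]
            refine lintegral_mono fun t => ?_
            by_cases ht : t ∈ Ioi x
            · have ht0 : 0 < t := hx.trans ht
              rw [indicator_of_mem ht, indicator_of_mem (show t ∈ Ioi (0 : ℝ) from ht0),
                indicator_of_mem (show l * t ∈ Ioi z from mul_lt_mul_of_pos_left ht hl),
                ← ENNReal.ofReal_mul (by positivity)]
              refine ENNReal.ofReal_le_ofReal (le_of_eq ?_)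
              rw [Real.mul_rpow hl.le ht0.le]
              field_simp
            · rw [indicator_of_notMem ht]; exact zero_le
        _ ≤ ENNReal.ofReal (l ^ (r * q') * l)⁻¹ * (ENNReal.ofReal (2 ^ (r * q') * (q' / (q' - 1))) *
              ∑' j, ENNReal.ofReal (a j)) := mul_le_mul' le_rfl hle
        _ = _ := by rw [← mul_assoc, ← ENNReal.ofReal_mul (by positivity)]
    calc _ ≤ (ENNReal.ofReal K * ∑' j, ENNReal.ofReal (a j)) ^ (1 / q') * W ^ (1 / q) := by gcongr
      _ = ENNReal.ofReal (K ^ (1 / q')) *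
            ((∑' j, ENNReal.ofReal (a j)) ^ (1 / q') * W ^ (1 / q)) := by
          rw [ENNReal.mul_rpow_of_nonneg _ _ (by positivity), ENNReal.ofReal_rpow_of_pos hK0,
            mul_assoc]
      _ ≤ ENNReal.ofReal (K ^ (1 / q')) * ENNReal.ofReal B₀ := mul_le_mul' le_rfl htsum
      _ = _ := (ENNReal.ofReal_mul (by positivity)).symm

/-- There is one operator of class `W`, on both domains, whose boundedness on simple functions
already forces the Cianchi condition. -/
theorem exists_extremal_operator [SigmaFinite μ] [SigmaFinite ν] (hμ : IsNonatomic μ)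
    (hν : IsNonatomic ν) (hμinf : μ univ = ∞) (hνinf : ν univ = ∞) (hr : 1 ≤ r) (hrp : r < p)
    (hφ₁ : IsYoungDensity φ₁) (hφ₂ : IsYoungDensity φ₂) :
    ∃ T : (X → ℝ) → (Y → ℝ), InClassW p r μ ν (simpleFunctions X) T ∧
      InClassW p r μ ν (lorentzAddLinfty p r μ) T ∧
      ((∃ C : ℝ, 0 < C ∧ ∀ f ∈ simpleFunctions X, f ∈ OrliczSpace (youngFun φ₂) μ →
        gaugeNorm (youngFun φ₁) ν (T f) ≤ ENNReal.ofReal C * gaugeNorm (youngFun φ₂) μ f) →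
        CianchiCondition p r φ₁ φ₂) := by
  obtain ⟨ψ, hψ, hψ0, hψν⟩ := hν.exists_measure_le_comparable hνinf
  refine ⟨calderonOp p r μ ψ,
    inClassW_calderonOp hr hrp hψ hψ0 hψν
      (simpleFunctions_subset_lorentzAddLinfty (by linarith) (by linarith)),
    inClassW_calderonOp hr hrp hψ hψ0 hψν le_rfl, ?_⟩
  rintro ⟨C, hC, hbdd⟩
  exact cianchiCondition_of_lorentz_bound hμ hμinf hr hrp hφ₂ (l := 2 * C) (by positivity)
    fun f hf x₀ _ hfx hint => lintegral_mul_lorentzNorm_rpow_le hr hrp hψ hψ0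
      (fun t ht => (hψν t ht).1) hφ₁ hC hbdd hf hfx hint

end Necessity
theorem mainTheorem2 {X Y : Type*} [MeasurableSpace X] [MeasurableSpace Y]
    (μ : Measure X) (ν : Measure Y) [SigmaFinite μ] [SigmaFinite ν]
    (hμ : μ univ = ∞) (hν : ν univ = ∞) (hνna : IsNonatomic ν) [IsSeparable ν]
    (p r : ℝ) (hp : 1 < p) (hr : 1 ≤ r) (hrp : r < p)
    (φ₁ φ₂ : ℝ → ℝ) (hφ₁ : IsYoungDensity φ₁) (hφ₂ : IsYoungDensity φ₂) :
    (CianchiCondition p r φ₁ φ₂ →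
      BoundedOnSimple p r μ ν (youngFun φ₁) (youngFun φ₂) ∧
      BoundedOnOrlicz p r μ ν (youngFun φ₁) (youngFun φ₂)) ∧
    (IsNonatomic μ →
      (BoundedOnSimple p r μ ν (youngFun φ₁) (youngFun φ₂) ↔ CianchiCondition p r φ₁ φ₂) ∧
      (BoundedOnOrlicz p r μ ν (youngFun φ₁) (youngFun φ₂) ↔ CianchiCondition p r φ₁ φ₂)) := by
  refine ⟨fun h => ⟨h.boundedOnSimple hr hrp hφ₁ hφ₂, h.boundedOnOrlicz hr hrp hφ₁ hφ₂⟩,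
    fun hμna => ?_⟩
  obtain ⟨T, hTS, hTL, hT⟩ :=
    exists_extremal_operator hμna hνna hμ hν hr hrp hφ₁ hφ₂
  refine ⟨⟨fun h => hT (h T hTS), fun h => h.boundedOnSimple hr hrp hφ₁ hφ₂⟩,
    ⟨fun h => ?_, fun h => h.boundedOnOrlicz hr hrp hφ₁ hφ₂⟩⟩
  obtain ⟨C, hC, hbdd⟩ := h T hTL
  exact hT ⟨C, hC, fun f _ hf => (hbdd f hf).2⟩
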